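/- Let $(\mathcal S,\mathcal A,R,P,\gamma)$ be a Markov decision process with $\gamma\in[0,1)$, let $\pi$ be a policy, let $[s;a]\in\mathbb R^{d_0}$ denote the input vector of a state-action pair (with finite expectation under $s'\sim P(\cdot|s,a)$, $a'\sim\pi(\cdot|s')$, for every $(s,a)$), and let $(s_i,a_i)$, $i=1,\dots,n$, be a finite data set. Let $N\ge 3$ and consider the deep linear Q-network $$Q(s,a)=W_N W_\phi\,[s;a],\qquad W_\phi=W_{N-1}W_{N-2}\cdots W_1,\qquad W_N\in\mathbb R^{1\times d_{N-1}},\quad W_j\in\mathbb R^{d_j\times d_{j-1}}\ (1\le j\le N-1).$$ The network is trained by fitted Q-iteration: let $W_j(k,t)$, $t\in[0,T]$, be the weights at time $t$ of fitting iteration $k=0,1,2,\dots$ (with $T>0$), and let $Q_k$ be the Q-function with the weights $W_j(k,0)$ at the beginning of iteration $k$. The objective of iteration $k$, as a function of a matrix $W\in\mathbb R^{1\times d_0}$, is $$L_{k+1}(W)=\sum_{i=1}^{n}\bigl(W[s_i;a_i]-y_k(s_i,a_i)\bigr)^2,\qquad y_k(s,a)=R(s,a)+\gamma\,\mathbb E_{s'\sim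 P(\cdot|s,a),\,a'\sim\pi(\cdot|s')}\bigl[Q_k(s',a')\bigr].$$ Assume that within each iteration all layers $j=1,\dots,N$ follow the gradient flow with learning rate $\eta>0$, $$\dot W_j(k,t)=-\eta\,\frac{\partial}{\partial W_j}L_{k+1}\bigl(W_NW_{N-1}\cdots W_1\bigr)\Big|_{(k,t)},$$ that $W_j(k+1,0)=W_j(k,T)$ for all $j,k$, and that the first $N-1$ layers are balanced at initialization: $W_{j+1}(0,0)^{\mathsf T}W_{j+1}(0,0)=W_j(0,0)W_j(0,0)^{\mathsf T}$ for $1\le j\le N-2$. Then, for every fitting iteration $k$, the singular values of the feature matrix $W_\phi(k,t)$ evolve according to $$\dot\sigma_r(k,t)=-\eta\,(N-1)\,\bigl(\sigma_r^2(k,t)\bigr)^{1-\frac1{N-1}}\Bigl\langle W_N(k,t)^{\mathsf T}\,\nabla L_{k+1}\bigl(W_N(k,t)W_\phi(k,t)\bigr),\ u_r(k,t)\,v_r(k,t)^{\mathsf T}\Bigr\rangle\qquad(\ast)$$ (Frobenius inner product; one-sided derivatives at $t=0$ and $t=T$), where $u_r$ and $v_r$ are the corresponding left and right singular vectors. Precisely: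 1. There are functions $\sigma_r:[0,T]\to[0,\infty)$ and continuous $u_r:[0,T]\to\mathbb R^{d_{N-1}}$, $v_r:[0,T]\to\mathbb R^{d_0}$, $1\le r\le\min(d_0,d_{N-1})$, such that for every $t$ the $u_r(t)$ are orthonormal, the $v_r(t)$ are orthonormal, $W_\phi(k,t)=\sum_r\sigma_r(t)u_r(t)v_r(t)^{\mathsf T}$, and every $\sigma_r$ is differentiable and satisfies $(\ast)$ on $[0,T]$. 2. Let $I\subseteq[0,T]$, and for $t\in I$ let $\sigma(t)\ge0$ and unit vectors $u(t),v(t)$, continuous in $t\in I$, satisfy $W_\phi(k,t)v(t)=\sigma(t)u(t)$ and $W_\phi(k,t)^{\mathsf T}u(t)=\sigma(t)v(t)$. Then $\sigma$ is differentiable within $I$ and satisfies $(\ast)$ at every $t\in I$. -/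

import Mathlib

open scoped Matrix

namespace DeepQ

/-! ### Policy evaluation in a Markov decision process -/

/-- A Markov decision process `(S, A, R, P, γ)`. -/
structure MDP (S A : Type*) [MeasurableSpace S] [MeasurableSpace A] where
  /-- the reward `R(s, a)` -/
  reward : S → A → ℝ
  measurable_reward : Measurable (Function.uncurry reward)
  /-- the transition dynamics `P(· | s, a)` -/
  trans : ProbabilityTheory.Kernel (S × A) S
  isMarkov_trans : ProbabilityTheory.IsMarkovKernel trans
  /-- the discount factor `γ ∈ [0, 1)` -/
  discount : ℝ
  discount_nonneg : 0 ≤ discount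
  discount_lt_one : discount < 1

/-- The law of the next state-action pair: `s' ∼ P(· | s, a)`, `a' ∼ π(· | s')`. -/
noncomputable def MDP.nextLaw {S A : Type*} [MeasurableSpace S] [MeasurableSpace A]
    (M : MDP S A) (pol : ProbabilityTheory.Kernel S A) (s : S) (a : A) :
    MeasureTheory.Measure (S × A) :=
  (M.trans (s, a)).compProd pol

/-- The Bellman backup `(R + γ P^π Q)(s, a)`. -/
noncomputable def MDP.bellman {S A : Type*} [MeasurableSpace S] [MeasurableSpace A]
    (M : MDP S A) (pol : ProbabilityTheory.Kernel S A) (Q : S → A → ℝ) (s : S) (a : A) : ℝ :=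
  M.reward s a + M.discount * ∫ p, Q p.1 p.2 ∂(M.nextLaw pol s a)

/-! ### Deep linear networks -/

/-- The weights of a deep linear network with `N` layers, layer widths `d 0, …, d (N - 1)` and a
scalar output. Layers are indexed from zero: `hidden j` is the matrix `W_{j+1}`, of size
`d (j + 1) × d j`, and `last` is `W_N`. Only `hidden j` with `j < N - 1` belong to the network. -/
structure Weights (N : ℕ) (d : ℕ → ℕ) where
  hidden : (j : ℕ) → Matrix (Fin (d (j + 1))) (Fin (d j)) ℝ
  last : Matrix (Fin 1) (Fin (d (N - 1))) ℝ

/-- The product `W_n W_{n-1} ⋯ W_1`. -/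
def layerProd {d : ℕ → ℕ} (W : (j : ℕ) → Matrix (Fin (d (j + 1))) (Fin (d j)) ℝ) :
    (n : ℕ) → Matrix (Fin (d n)) (Fin (d 0)) ℝ
  | 0 => 1
  | n + 1 => W n * layerProd W n

/-- The feature matrix `W_φ = W_{N-1} ⋯ W_1`. -/
def Weights.feature {N : ℕ} {d : ℕ → ℕ} (θ : Weights N d) :
    Matrix (Fin (d (N - 1))) (Fin (d 0)) ℝ :=
  layerProd θ.hidden (N - 1)

/-- The end-to-end matrix `W_{N:1} = W_N W_φ`. -/
def Weights.endToEnd {N : ℕ} {d : ℕ → ℕ} (θ : Weights N d) : Matrix (Fin 1) (Fin (d 0)) ℝ :=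
  θ.last * θ.feature

/-- The Q-function `Q(s, a) = W_N W_φ [s; a]`, where `x s a` is the input vector `[s; a]`. -/
def Weights.qFun {N : ℕ} {d : ℕ → ℕ} {S A : Type*} (θ : Weights N d)
    (x : S → A → Fin (d 0) → ℝ) (s : S) (a : A) : ℝ :=
  (θ.endToEnd *ᵥ x s a) 0

/-- The first `N - 1` layers are balanced:
`W_{j+1}ᵀ W_{j+1} = W_j W_jᵀ` for `j = 1, …, N - 2`. -/
def Weights.Balanced {N : ℕ} {d : ℕ → ℕ} (θ : Weights N d) : Prop :=
  ∀ j : ℕ, j + 1 < N - 1 →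
    (θ.hidden (j + 1))ᵀ * θ.hidden (j + 1) = θ.hidden j * (θ.hidden j)ᵀ

/-! ### The objective, its gradients, and the gradient flow -/

/-- The squared TD error `∑ i, (E [s_i; a_i] - y(s_i, a_i))²` on a data set, as a function of the
end-to-end matrix `E`, for a fixed target function `y`. -/
def tdLoss {S A : Type*} {n d₀ : ℕ} (x : S → A → Fin d₀ → ℝ) (data : Fin n → S × A)
    (y : S → A → ℝ) (E : Matrix (Fin 1) (Fin d₀) ℝ) : ℝ :=
  ∑ i, ((E *ᵥ x (data i).1 (data i).2) 0 - y (data i).1 (data i).2) ^ 2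

/-- The gradient of a function of a matrix: the matrix of its partial derivatives. -/
noncomputable def matGrad {m n : Type*} [DecidableEq m] [DecidableEq n]
    (f : Matrix m n ℝ → ℝ) (X : Matrix m n ℝ) : Matrix m n ℝ :=
  Matrix.of fun a b => deriv (fun h : ℝ => f (X + h • Matrix.single a b 1)) 0

/-- The partial gradient, with respect to `hidden j`, of `θ ↦ L (W_{N:1})`. -/
noncomputable def gradHidden {N : ℕ} {d : ℕ → ℕ} (L : Matrix (Fin 1) (Fin (d 0)) ℝ → ℝ)
    (θ : Weights N d) (j : ℕ) : Matrix (Fin (d (j + 1))) (Fin (d j)) ℝ :=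
  matGrad (fun X => L (Weights.endToEnd { θ with hidden := Function.update θ.hidden j X }))
    (θ.hidden j)

/-- The partial gradient, with respect to `last`, of `θ ↦ L (W_{N:1})`. -/
noncomputable def gradLast {N : ℕ} {d : ℕ → ℕ} (L : Matrix (Fin 1) (Fin (d 0)) ℝ → ℝ)
    (θ : Weights N d) : Matrix (Fin 1) (Fin (d (N - 1))) ℝ :=
  matGrad (fun X => L (Weights.endToEnd { θ with last := X })) θ.last

/-- The objective of a fitting iteration that starts from the weights `θ₀`: the squared TD error
for the targets `R + γ P^π Q_{θ₀}`. -/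
noncomputable def fittingLoss {S A : Type*} [MeasurableSpace S] [MeasurableSpace A]
    {N n : ℕ} {d : ℕ → ℕ} (M : MDP S A) (pol : ProbabilityTheory.Kernel S A)
    (x : S → A → Fin (d 0) → ℝ) (data : Fin n → S × A) (θ₀ : Weights N d) :
    Matrix (Fin 1) (Fin (d 0)) ℝ → ℝ :=
  tdLoss x data (M.bellman pol (θ₀.qFun x))

/-- Neural fitted Q-iteration with gradient flow. `θ k t` are the weights at time `t ∈ [0, T]` of
fitting iteration `k`. Within each iteration every layer follows the gradient flow, with learning
rate `η`, of the squared TD error whose targets are computed from the Q-function at the beginning of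
the iteration; each iteration starts from the final weights of the previous one. -/
structure IsFittedQFlow {S A : Type*} [MeasurableSpace S] [MeasurableSpace A]
    {N n : ℕ} {d : ℕ → ℕ} (M : MDP S A) (pol : ProbabilityTheory.Kernel S A)
    (x : S → A → Fin (d 0) → ℝ) (data : Fin n → S × A) (η T : ℝ)
    (θ : ℕ → ℝ → Weights N d) : Prop where
  flow_hidden : ∀ k, ∀ t ∈ Set.Icc 0 T, ∀ j, j < N - 1 → ∀ a b,
    HasDerivWithinAt (fun τ => (θ k τ).hidden j a b)
      (-η * gradHidden (fittingLoss M pol x data (θ k 0)) (θ k t) j a b) (Set.Icc 0 T) t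
  flow_last : ∀ k, ∀ t ∈ Set.Icc 0 T, ∀ a b,
    HasDerivWithinAt (fun τ => (θ k τ).last a b)
      (-η * gradLast (fittingLoss M pol x data (θ k 0)) (θ k t) a b) (Set.Icc 0 T) t
  restart_hidden : ∀ k, ∀ j, j < N - 1 → (θ (k + 1) 0).hidden j = (θ k T).hidden j
  restart_last : ∀ k, (θ (k + 1) 0).last = (θ k T).last

/-! ### Singular values -/

/-- `σ` is a singular value of `X` with left and right (unit) singular vectors `u` and `v`. -/
structure IsSingularTriple {m n : Type*} [Fintype m] [Fintype n] (X : Matrix m n ℝ)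
    (σ : ℝ) (u : m → ℝ) (v : n → ℝ) : Prop where
  nonneg : 0 ≤ σ
  left_unit : u ⬝ᵥ u = 1
  right_unit : v ⬝ᵥ v = 1
  mulVec_right : X *ᵥ v = σ • u
  mulVec_left : Xᵀ *ᵥ u = σ • v

/-- `X = ∑ r, σ_r u_r v_rᵀ` is a (reduced) singular value decomposition of the `m × n` matrix `X`,
with `min n m` singular values, listed with multiplicity and in any order. -/
structure IsSVD {m n : ℕ} (X : Matrix (Fin m) (Fin n) ℝ) (σ : Fin (min n m) → ℝ)
    (u : Fin (min n m) → Fin m → ℝ) (v : Fin (min n m) → Fin n → ℝ) : Prop where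
  nonneg : ∀ r, 0 ≤ σ r
  left_orthonormal : ∀ r s, u r ⬝ᵥ u s = if r = s then 1 else 0
  right_orthonormal : ∀ r s, v r ⬝ᵥ v s = if r = s then 1 else 0
  eq_sum : X = ∑ r, σ r • Matrix.vecMulVec (u r) (v r)

/-- The Frobenius inner product `⟨X, Y⟩ = ∑ a b, X a b * Y a b`. -/
def frob {m n : Type*} [Fintype m] [Fintype n] (X Y : Matrix m n ℝ) : ℝ :=
  ∑ a, ∑ b, X a b * Y a b

/-- The velocity
`-η (N - 1) (σ²)^(1 - 1/(N-1)) ⟨W_Nᵀ dL/dW (W_{N:1}), u vᵀ⟩` of a singular value `σ` of `W_φ` with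
singular vectors `u`, `v`. -/
noncomputable def singularVelocity {N : ℕ} {d : ℕ → ℕ} (η : ℝ)
    (L : Matrix (Fin 1) (Fin (d 0)) ℝ → ℝ) (θ : Weights N d)
    (σ : ℝ) (u : Fin (d (N - 1)) → ℝ) (v : Fin (d 0) → ℝ) : ℝ :=
  -(η * ((N : ℝ) - 1)) * (σ ^ 2) ^ (1 - 1 / ((N : ℝ) - 1)) *
    frob (θ.lastᵀ * matGrad L θ.endToEnd) (Matrix.vecMulVec u v)

end DeepQ

/-! Write `m = N - 1`, `X = W_φ` and `M = W_Nᵀ ∇L`. Within one iteration the targets are frozen, so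
`L` is a fixed quadratic function and the gradient in layer `j` is (product above)ᵀ `M` (product
below)ᵀ.

The differential equation. Gradient flow conserves `W_{j+1}ᵀ W_{j+1} - W_j W_jᵀ`, and restarts keep
the weights, so balancedness holds at all times. It gives `Xᵀ X = (W₁ᵀ W₁)^m` and `X Xᵀ = (W_m
W_mᵀ)^m`, and the Gram matrices of the partial products are lower powers of the same two matrices.
Hence, for a singular triple `(σ, u, v)` of `X`, both `v` and `u` are eigenvectors of these
matrices, with eigenvalue `μ = (σ²)^(1/m)`, and each of the `m` terms of `u ⬝ X' v` equals `-η
μ^(m-1) u ⬝ M v` (`IsLayerFlow.dotProduct_velocity`). Moreover `σ' = u ⬝ X' v` needs only continuity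
of `u` and `v` (`hasDerivWithinAt_singularValue`). This is the second claim.

Existence of a continuous decomposition. Smooth symmetric families need not have continuous
eigenvectors, but analytic ones do (Rellich). The weights solve a polynomial system, so they are
analytic up to the endpoints (`analytic_of_polynomial`), and `W₁ᵀ W₁` and `W_m W_mᵀ` have continuous
orthonormal eigenframes on `[0, T]` (`exists_isEigenframe`). The first frame supplies the `v_r`.
Where `σ_r > 0`, `u_r = X v_r / σ_r`; this is continuous provided that `σ_r` never reaches zero.
Indeed an eigenvalue `μ` of `W₁ᵀ W₁` with a continuous eigenvector satisfies `|μ'| ≤ C μ`, because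
the velocity of `W₁` factors through `W₂ᵀ` and `W₂ᵀ W₂ = W₁ W₁ᵀ` (`eigenvalue_eq_zero_of_eq_zero`).
By Grönwall it vanishes nowhere or everywhere. This uses two hidden layers, hence `N ≥ 3`. The rank
of `X` is therefore constant, and the missing `u_r` are the null vectors of the second frame. -/

namespace DeepQ

open Set Filter Topology

/-! ### Analyticity of solutions of polynomial differential equations -/


/-- A function whose derivative is bounded by a multiple of the function vanishes on an interval as
soon as it vanishes at one point. -/
theorem eqOn_zero_of_norm_deriv_le {E : Type*} [NormedAddCommGroup E] [NormedSpace ℝ E]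
    {f f' : ℝ → E} {a b K t₀ : ℝ}
    (hf : ∀ t ∈ Icc a b, HasDerivWithinAt f (f' t) (Icc a b) t)
    (hK : ∀ t ∈ Icc a b, ‖f' t‖ ≤ K * ‖f t‖) (ht₀ : t₀ ∈ Icc a b) (h0 : f t₀ = 0) :
    ∀ t ∈ Icc a b, f t = 0 := by
  intro t ht
  rcases le_total t₀ t with h | h
  · have hsub : Icc t₀ b ⊆ Icc a b := Icc_subset_Icc_left ht₀.1
    refine eq_zero_of_abs_deriv_le_mul_abs_self_of_eq_zero_right (a := t₀) (b := b) (f' := f')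
      (K := K) (fun s hs => ((hf s (hsub hs)).continuousWithinAt.mono hsub)) ?_ h0
      (fun s hs => hK s (hsub ⟨hs.1, hs.2.le⟩)) t ⟨h, ht.2⟩
    intro s hs
    have hs' := hsub ⟨hs.1, hs.2.le⟩
    refine (hf s hs').mono_of_mem_nhdsWithin ?_
    exact mem_of_superset (Icc_mem_nhdsGE hs.2) (Icc_subset_Icc_left hs'.1)
  -- To the left of `t₀`, time is reversed and the forward Grönwall estimate is applied to `s ↦ f
  -- (-s)`.
  · have hsub : ∀ s ∈ Icc (-t₀) (-a), -s ∈ Icc a b := fun s hs =>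
      ⟨by linarith [hs.2], by linarith [hs.1, ht₀.2]⟩
    have key := eq_zero_of_abs_deriv_le_mul_abs_self_of_eq_zero_right (a := -t₀) (b := -a)
      (f := fun s => f (-s)) (f' := fun s => -f' (-s)) (K := K) ?_ ?_ (by simpa using h0)
      (fun s hs => by simpa using hK _ (hsub s ⟨hs.1, hs.2.le⟩)) (-t) ⟨by linarith, by linarith [ht.1]⟩
    · simpa using key
    · intro s hs
      exact ((hf _ (hsub s hs)).continuousWithinAt).comp continuous_neg.continuousWithinAt
        (fun r hr => hsub r hr)
    · intro s hs
      have hs' := hsub s ⟨hs.1, hs.2.le⟩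
      have h1 : HasDerivWithinAt f (f' (-s)) (Iic (-s)) (-s) := by
        refine (hf _ hs').mono_of_mem_nhdsWithin ?_
        exact mem_of_superset (Icc_mem_nhdsLE (by linarith [hs.2])) (Icc_subset_Icc_right hs'.2)
      have h2 := HasDerivWithinAt.scomp s h1 ((hasDerivAt_neg s).hasDerivWithinAt (s := Ici s))
        (fun r hr => by simpa using hr)
      simpa [Function.comp_def] using h2

/-! ### Power series with geometrically bounded coefficients -/

section PowerSeries

variable {a : ℕ → ℝ} {M q s : ℝ}

theorem summable_abs_mul_pow_of_le (hq : 0 < q) (ha : ∀ n, |a n| ≤ M * q ^ n)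
    (hs : |s| < 1 / (2 * q)) : Summable fun n => ‖a n * s ^ n‖ := by
  have hqs : q * |s| < 1 := by
    rw [lt_div_iff₀ (by positivity)] at hs
    nlinarith
  refine Summable.of_nonneg_of_le (fun _ => norm_nonneg _) (fun n => ?_)
    ((summable_geometric_of_lt_one (by positivity) hqs).mul_left M)
  rw [norm_mul, norm_pow, Real.norm_eq_abs, Real.norm_eq_abs, mul_pow, ← mul_assoc]
  gcongr
  exact ha n

/-- Restricting to half of the guaranteed radius `1 / q` leaves a factor `2⁻ⁿ`, so the
differentiated terms are dominated by a multiple of `n 2⁻ⁿ` uniformly on the ball, which permits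
termwise differentiation. -/
theorem hasDerivAt_tsum_mul_pow (hq : 0 < q) (ha : ∀ n, |a n| ≤ M * q ^ n)
    (hs : |s| < 1 / (2 * q)) :
    HasDerivAt (fun s => ∑' n, a n * s ^ n) (∑' n, (n + 1) * a (n + 1) * s ^ n) s := by
  have hu : Summable fun n : ℕ => 2 * q * M * ((n : ℝ) ^ 1 * (1 / 2 : ℝ) ^ n) :=
    Summable.mul_left _ (summable_pow_mul_geometric_of_norm_lt_one (R := ℝ) 1
      (by rw [Real.norm_eq_abs, abs_of_pos] <;> norm_num))
  have bound : ∀ (n : ℕ) (y : ℝ), y ∈ Metric.ball (0 : ℝ) (1 / (2 * q)) →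
      ‖a n * (n * y ^ (n - 1))‖ ≤ 2 * q * M * ((n : ℝ) ^ 1 * (1 / 2 : ℝ) ^ n) := by
    intro n y hy
    rw [mem_ball_zero_iff, Real.norm_eq_abs] at hy
    rcases n with _ | n
    · simp
    rw [norm_mul, norm_mul, norm_pow, Real.norm_eq_abs, Real.norm_eq_abs, Real.norm_eq_abs,
      Nat.abs_cast, Nat.add_sub_cancel]
    calc |a (n + 1)| * (((n + 1 : ℕ) : ℝ) * |y| ^ n)
        ≤ M * q ^ (n + 1) * (((n + 1 : ℕ) : ℝ) * (1 / (2 * q)) ^ n) := by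
          gcongr
          · exact (abs_nonneg _).trans (ha _)
          · exact ha _
      _ = 2 * q * M * (((n + 1 : ℕ) : ℝ) ^ 1 * (1 / 2 : ℝ) ^ (n + 1)) := by
          rw [one_div, mul_inv, mul_pow, inv_pow q, pow_succ q]
          field_simp
          ring
  have hder := hasDerivAt_tsum_of_isPreconnected (y := s) (y₀ := 0)
    (g := fun n s => a n * s ^ n) (g' := fun n s => a n * (n * s ^ (n - 1))) hu
    Metric.isOpen_ball ((convex_ball _ _).isPreconnected)
    (fun n y _ => (hasDerivAt_pow n y).const_mul (a n)) bound
    (Metric.mem_ball_self (by positivity))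
    (summable_of_ne_finset_zero (s := {0}) (fun n hn => by
      simp only [Finset.mem_singleton] at hn; simp [hn])) (by simpa using hs)
  have hsum : Summable fun n : ℕ => a n * (n * s ^ (n - 1)) :=
    hu.of_norm_bounded fun n => bound n s (by simpa using hs)
  have heq : ∑' n : ℕ, a n * (n * s ^ (n - 1)) = ∑' n : ℕ, (n + 1) * a (n + 1) * s ^ n := by
    rw [hsum.tsum_eq_zero_add]
    simp only [CharP.cast_eq_zero, zero_mul, mul_zero, zero_add, Nat.cast_add, Nat.cast_one,
      Nat.add_sub_cancel]
    exact tsum_congr fun n => by ring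
  rwa [heq] at hder

theorem analyticAt_tsum_mul_pow (hq : 0 < q) (ha : ∀ n, |a n| ≤ M * q ^ n) :
    AnalyticAt ℝ (fun s => ∑' n, a n * s ^ n) 0 := by
  have hr : 0 < (FormalMultilinearSeries.ofScalars ℝ a).radius := by
    refine lt_of_lt_of_le ?_ (FormalMultilinearSeries.le_radius_of_bound _ M
      (r := q⁻¹.toNNReal) fun n => ?_)
    · simpa using hq
    · rw [FormalMultilinearSeries.ofScalars_norm, Real.coe_toNNReal _ (by positivity), inv_pow]
      exact mul_inv_le_of_le_mul₀ (by positivity)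
        (by simpa using (abs_nonneg _).trans (ha 0)) (ha n)
  have := (FormalMultilinearSeries.hasFPowerSeriesOnBall _ hr).analyticAt
  refine this.congr (Eventually.of_forall fun s => ?_)
  simp [FormalMultilinearSeries.sum, mul_comm]

end PowerSeries

/-! ### Quadratic systems of differential equations -/

section Quadratic

variable {κ : Type*} [Fintype κ] (c : κ → κ → κ → ℝ) (z₀ : κ → ℝ)

/-- The Taylor coefficients of the solution of `z_k' = ∑ i j, c k i j * z_i * z_j` with `z(0) = z₀`. -/
noncomputable def quadraticCoeff : ℕ → κ → ℝ
  | 0 => z₀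
  | n + 1 => fun k => (∑ i, ∑ j, c k i j * ∑ l : Fin (n + 1),
      quadraticCoeff l i * quadraticCoeff (n - l) j) / (n + 1)

theorem succ_mul_quadraticCoeff (n : ℕ) (k : κ) :
    (n + 1) * quadraticCoeff c z₀ (n + 1) k = ∑ i, ∑ j, c k i j *
      ∑ p ∈ Finset.HasAntidiagonal.antidiagonal n, quadraticCoeff c z₀ p.1 i * quadraticCoeff c z₀ p.2 j := by
  rw [quadraticCoeff, mul_div_cancel₀ _ (by positivity)]
  refine Finset.sum_congr rfl fun i _ => Finset.sum_congr rfl fun j _ => ?_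
  rw [Finset.Nat.sum_antidiagonal_eq_sum_range_succ
    (fun a b => quadraticCoeff c z₀ a i * quadraticCoeff c z₀ b j), Finset.sum_range]

/-- With `M` bounding the initial data and `b` the total size of `c`, the bound `M (b M)ⁿ`
reproduces itself under the recursion: the `n + 1` terms of the Cauchy product cancel the division
by `n + 1`. -/
theorem exists_abs_quadraticCoeff_le : ∃ M q : ℝ, 0 < q ∧
    ∀ n k, |quadraticCoeff c z₀ n k| ≤ M * q ^ n := by
  set M : ℝ := ∑ k, |z₀ k| + 1 with hM
  set b : ℝ := ∑ k, ∑ i, ∑ j, |c k i j| + 1 with hb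
  have hM0 : 0 < M := by positivity
  have hb0 : 0 < b := by positivity
  have hbk : ∀ k, ∑ i, ∑ j, |c k i j| ≤ b := fun k => by
    have := Finset.single_le_sum (f := fun k => ∑ i, ∑ j, |c k i j|)
      (fun k _ => by positivity) (Finset.mem_univ k)
    linarith
  refine ⟨M, b * M, by positivity, fun n => ?_⟩
  induction n using Nat.strong_induction_on with
  | _ n ih =>
    intro k
    rcases n with _ | n
    · have := Finset.single_le_sum (f := fun k => |z₀ k|)
        (fun k _ => by positivity) (Finset.mem_univ k)
      simp only [quadraticCoeff, pow_zero, mul_one]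
      linarith
    · have hn : (0 : ℝ) < n + 1 := by positivity
      have key : |(n + 1) * quadraticCoeff c z₀ (n + 1) k| ≤
          ∑ i, ∑ j, |c k i j| * ((n + 1) * (M * M * (b * M) ^ n)) := by
        rw [succ_mul_quadraticCoeff]
        refine (Finset.abs_sum_le_sum_abs _ _).trans (Finset.sum_le_sum fun i _ => ?_)
        refine (Finset.abs_sum_le_sum_abs _ _).trans (Finset.sum_le_sum fun j _ => ?_)
        rw [abs_mul]
        gcongr
        refine (Finset.abs_sum_le_sum_abs _ _).trans ?_
        refine (Finset.sum_le_card_nsmul _ _ (M * M * (b * M) ^ n) fun p hp => ?_).trans_eq ?_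
        · have hp' := Finset.HasAntidiagonal.mem_antidiagonal.1 hp
          rw [abs_mul]
          calc _ ≤ (M * (b * M) ^ p.1) * (M * (b * M) ^ p.2) := by
                gcongr
                · exact ih _ (by omega) _
                · exact ih _ (by omega) _
            _ = _ := by rw [← hp', pow_add]; ring
        · simp
      simp_rw [← Finset.sum_mul] at key
      rw [abs_mul, abs_of_pos hn] at key
      have h2 : (n + 1 : ℝ) * |quadraticCoeff c z₀ (n + 1) k| ≤
          (n + 1) * (M * (b * M) ^ (n + 1)) := by
        refine key.trans ?_
        calc _ ≤ b * ((n + 1) * (M * M * (b * M) ^ n)) := by gcongr; exact hbk k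
          _ = _ := by ring
      exact le_of_mul_le_mul_left h2 hn

/-- A quadratic system of differential equations has analytic local solutions. -/
theorem exists_analytic_solution_quadratic (t₀ : ℝ) : ∃ (y : κ → ℝ → ℝ) (r : ℝ), 0 < r ∧
    (∀ k, AnalyticAt ℝ (y k) t₀) ∧ (∀ k, y k t₀ = z₀ k) ∧
    ∀ t, |t - t₀| < r → ∀ k, HasDerivAt (y k) (∑ i, ∑ j, c k i j * (y i t * y j t)) t := by
  obtain ⟨M, q, hq, hbound⟩ := exists_abs_quadraticCoeff_le c z₀
  set a := quadraticCoeff c z₀ with ha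
  refine ⟨fun k t => ∑' n, a n k * (t - t₀) ^ n, 1 / (2 * q), by positivity, fun k => ?_,
    fun k => ?_, fun t ht k => ?_⟩
  · have h1 := analyticAt_tsum_mul_pow (a := fun n => a n k) hq (fun n => hbound n k)
    exact AnalyticAt.comp_of_eq (g := fun s => ∑' n, a n k * s ^ n) (f := fun t => t - t₀)
      h1 (by fun_prop) (by simp)
  · simp only [sub_self]
    rw [tsum_eq_single 0 (fun n hn => by simp [hn])]
    simp [ha, quadraticCoeff]
  · have h1 := hasDerivAt_tsum_mul_pow (a := fun n => a n k) hq (fun n => hbound n k) ht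
    have h2 := h1.comp_sub_const t t₀
    refine h2.congr_deriv ?_
    have hs : ∀ i, Summable fun n => ‖a n i * (t - t₀) ^ n‖ := fun i =>
      summable_abs_mul_pow_of_le hq (fun n => hbound n i) ht
    have hterm : ∀ n : ℕ, ((n : ℝ) + 1) * a (n + 1) k * (t - t₀) ^ n = ∑ i, ∑ j, c k i j *
        ∑ p ∈ Finset.HasAntidiagonal.antidiagonal n, (a p.1 i * (t - t₀) ^ p.1) * (a p.2 j * (t - t₀) ^ p.2) := by
      intro n
      rw [ha, succ_mul_quadraticCoeff, Finset.sum_mul]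
      refine Finset.sum_congr rfl fun i _ => ?_
      rw [Finset.sum_mul]
      refine Finset.sum_congr rfl fun j _ => ?_
      rw [mul_assoc, Finset.sum_mul]
      congr 1
      refine Finset.sum_congr rfl fun p hp => ?_
      rw [← Finset.HasAntidiagonal.mem_antidiagonal.1 hp, pow_add]
      ring
    have hsum : ∀ i j, Summable fun n => ∑ p ∈ Finset.HasAntidiagonal.antidiagonal n,
        (a p.1 i * (t - t₀) ^ p.1) * (a p.2 j * (t - t₀) ^ p.2) := fun i j =>
      (summable_norm_sum_mul_antidiagonal_of_summable_norm (hs i) (hs j)).of_norm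
    rw [tsum_congr hterm]
    rw [Summable.tsum_finsetSum (fun i _ => summable_sum fun j _ => (hsum i j).mul_left _)]
    refine Finset.sum_congr rfl fun i _ => ?_
    rw [Summable.tsum_finsetSum (fun j _ => (hsum i j).mul_left _)]
    refine Finset.sum_congr rfl fun j _ => ?_
    rw [tsum_mul_left, tsum_mul_tsum_eq_tsum_sum_antidiagonal_of_summable_norm (hs i) (hs j)]

/-- Solutions of quadratic systems of differential equations are analytic, up to the boundary. -/
theorem analytic_of_quadratic {z : κ → ℝ → ℝ} {T t₀ : ℝ}
    (hz : ∀ t ∈ Icc 0 T, ∀ k,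
      HasDerivWithinAt (z k) (∑ i, ∑ j, c k i j * (z i t * z j t)) (Icc 0 T) t)
    (ht₀ : t₀ ∈ Icc 0 T) :
    ∃ y : κ → ℝ → ℝ, (∀ k, AnalyticAt ℝ (y k) t₀) ∧ ∀ᶠ t in 𝓝[Icc 0 T] t₀, ∀ k, z k t = y k t := by
  obtain ⟨y, r, hr, hy, hy0, hyd⟩ := exists_analytic_solution_quadratic c (fun k => z k t₀) t₀
  refine ⟨y, hy, ?_⟩
  set a := max 0 (t₀ - r / 2) with ha
  set b := min T (t₀ + r / 2) with hb
  have hat : a ≤ t₀ := max_le ht₀.1 (by linarith)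
  have hbt : t₀ ≤ b := le_min ht₀.2 (by linarith)
  have hsub : Icc a b ⊆ Icc 0 T := Icc_subset_Icc (le_max_left _ _) (min_le_left _ _)
  have hball : ∀ t ∈ Icc a b, |t - t₀| < r := fun t ht => by
    have h1 := (le_max_right _ _).trans ht.1
    have h2 := ht.2.trans (min_le_right _ _)
    rw [abs_lt]
    constructor <;> linarith
  have hzc : ∀ k, ContinuousOn (z k) (Icc a b) := fun k t ht =>
    ((hz t (hsub ht) k).continuousWithinAt).mono hsub
  have hyc : ∀ k, ContinuousOn (y k) (Icc a b) := fun k t ht =>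
    (hyd t (hball t ht) k).continuousAt.continuousWithinAt
  have hbdd : ∀ f : κ → ℝ → ℝ, (∀ k, ContinuousOn (f k) (Icc a b)) →
      ∃ C, ∀ t ∈ Icc a b, ∀ k, |f k t| ≤ C := by
    intro f hf
    have hc : ContinuousOn (fun t k => f k t) (Icc a b) := continuousOn_pi.2 hf
    obtain ⟨C, hC⟩ := (isCompact_Icc (a := a) (b := b)).exists_bound_of_continuousOn hc
    exact ⟨C, fun t ht k => (norm_le_pi_norm (fun k => f k t) k).trans (hC t ht)⟩
  obtain ⟨C₁, hC₁⟩ := hbdd z hzc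
  obtain ⟨C₂, hC₂⟩ := hbdd y hyc
  -- A Lipschitz constant of the quadratic field on the region visited by both solutions; the
  -- difference of the two then vanishes by Grönwall.
  set K : ℝ := ∑ k, ∑ i, ∑ j, |c k i j| * (C₁ + C₂)
  have hdiff : ∀ t ∈ Icc a b, (fun k => z k t - y k t) = 0 := by
    refine eqOn_zero_of_norm_deriv_le (a := a) (b := b) (t₀ := t₀)
      (f := fun t k => z k t - y k t) (K := K)
      (f' := fun t k => ∑ i, ∑ j, c k i j * (z i t * z j t) - ∑ i, ∑ j, c k i j * (y i t * y j t))
      (fun t ht => hasDerivWithinAt_pi.2 fun k => ((hz t (hsub ht) k).mono hsub).sub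
        (hyd t (hball t ht) k).hasDerivWithinAt) ?_ ⟨hat, hbt⟩ (by funext k; simp [hy0])
    intro t ht
    rcases isEmpty_or_nonempty κ with hκ | ⟨⟨k₀⟩⟩
    · simp [Subsingleton.elim _ (0 : κ → ℝ)]
    have hC₁0 : 0 ≤ C₁ := (abs_nonneg _).trans (hC₁ t ht k₀)
    have hC₂0 : 0 ≤ C₂ := (abs_nonneg _).trans (hC₂ t ht k₀)
    refine (pi_norm_le_iff_of_nonneg (by positivity)).2 fun k => ?_
    have hle : ∑ i, ∑ j, |c k i j| * (C₁ + C₂) ≤ K :=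
      Finset.single_le_sum (f := fun k => ∑ i, ∑ j, |c k i j| * (C₁ + C₂))
        (fun k _ => by positivity) (Finset.mem_univ k)
    refine le_trans ?_ (mul_le_mul_of_nonneg_right hle (norm_nonneg _))
    simp_rw [← Finset.sum_sub_distrib, Finset.sum_mul, ← mul_sub]
    refine (norm_sum_le _ _).trans (Finset.sum_le_sum fun i _ => ?_)
    refine (norm_sum_le _ _).trans (Finset.sum_le_sum fun j _ => ?_)
    rw [norm_mul, Real.norm_eq_abs, mul_assoc]
    gcongr
    set δ := ‖fun k => z k t - y k t‖
    have hi : |z i t - y i t| ≤ δ := norm_le_pi_norm (fun k => z k t - y k t) i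
    have hj : |z j t - y j t| ≤ δ := norm_le_pi_norm (fun k => z k t - y k t) j
    calc |z i t * z j t - y i t * y j t|
        = |(z i t - y i t) * z j t + y i t * (z j t - y j t)| := by congr 1; ring
      _ ≤ δ * C₁ + C₂ * δ := by
          refine (abs_add_le _ _).trans ?_
          rw [abs_mul, abs_mul]
          gcongr
          · exact hC₁ t ht j
          · exact hC₂ t ht i
      _ = (C₁ + C₂) * δ := by ring
  have hnhds : Icc a b ∈ 𝓝[Icc 0 T] t₀ := by
    have h1 : Icc (t₀ - r / 2) (t₀ + r / 2) ∈ 𝓝 t₀ := Icc_mem_nhds (by linarith) (by linarith)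
    refine mem_of_superset (inter_mem_nhdsWithin _ h1) fun t ht => ?_
    exact ⟨max_le ht.1.1 ht.2.1, le_min ht.1.2 ht.2.2⟩
  filter_upwards [hnhds] with t ht k
  exact sub_eq_zero.1 (congrFun (hdiff t ht) k)

end Quadratic

/-! ### Reduction of polynomial systems to quadratic ones -/

section Polynomial

variable {ι : Type*} [Finite ι]

/-- Solutions of polynomial systems of differential equations are analytic, up to the boundary. -/
theorem analytic_of_polynomial {y : ι → ℝ → ℝ} {g : ι → ℝ → ℝ} {T t₀ : ℝ}
    (hg : ∀ i, g i ∈ Algebra.adjoin ℝ (range y))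
    (hy : ∀ t ∈ Icc 0 T, ∀ i, HasDerivWithinAt (y i) (g i t) (Icc 0 T) t)
    (ht₀ : t₀ ∈ Icc 0 T) :
    ∃ x : ι → ℝ → ℝ, (∀ k, AnalyticAt ℝ (x k) t₀) ∧ ∀ᶠ t in 𝓝[Icc 0 T] t₀, ∀ k, y k t = x k t := by
  classical
  have := Fintype.ofFinite ι
  have hp : ∀ i, ∃ p : MvPolynomial ι ℝ, ∀ t, g i t = MvPolynomial.eval (fun j => y j t) p := by
    intro i
    obtain ⟨p, hp⟩ := (Algebra.adjoin_range_eq_range_aeval ℝ y ▸ hg i : g i ∈ (MvPolynomial.aeval y).range)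
    refine ⟨p, fun t => ?_⟩
    have h1 := congrArg (Pi.evalAlgHom ℝ (fun _ : ℝ => ℝ) t) hp
    have h2 : (Pi.evalAlgHom ℝ (fun _ : ℝ => ℝ) t).comp (MvPolynomial.aeval y) =
        MvPolynomial.aeval (fun j => y j t) := MvPolynomial.algHom_ext fun j => by simp
    rw [← MvPolynomial.coe_aeval_eq_eval]
    exact h1.symm.trans (DFunLike.congr_fun h2 p)
  choose p hp using hp
  -- `1 ≤ D` ensures that each coordinate `y i` is itself among the monomials below, so that its
  -- analyticity can be read off at the end.
  obtain ⟨D, hD, hD1⟩ : ∃ D : ℕ, (∀ i j, (p i).degreeOf j ≤ D) ∧ 1 ≤ D :=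
    ⟨∑ i, ∑ j, (p i).degreeOf j + 1, fun i j => by
      have h1 := Finset.single_le_sum (f := fun j => (p i).degreeOf j) (fun _ _ => Nat.zero_le _)
        (Finset.mem_univ j)
      have h2 := Finset.single_le_sum (f := fun i => ∑ j, (p i).degreeOf j)
        (fun _ _ => Nat.zero_le _) (Finset.mem_univ i)
      exact (h1.trans h2).trans (Nat.le_succ _), Nat.succ_le_succ (Nat.zero_le _)⟩
  -- The monomials with all exponents at most `D` solve a quadratic system: the derivative of `y^α`
  -- is the sum over `i` of `α i` times `y^(α - e_i)` times `g i`, and `g i` is a linear combination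
  -- of such monomials.
  let mon : (ι → Fin (D + 1)) → ℝ → ℝ := fun α t => ∏ i, y i t ^ (α i : ℕ)
  -- The truncated subtraction is harmless when `α i = 0`, since the term then carries the factor `α
  -- i`.
  let low : (ι → Fin (D + 1)) → ι → (ι → Fin (D + 1)) := fun α i =>
    Function.update α i ⟨α i - 1, by omega⟩
  let co : (ι → Fin (D + 1)) → ι → ℝ := fun β i =>
    (p i).coeff (Finsupp.equivFunOnFinite.symm fun j => (β j : ℕ))
  have heval : ∀ i t, g i t = ∑ β, co β i * mon β t := by
    intro i t
    have hinj : Function.Injective fun β : ι → Fin (D + 1) =>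
        Finsupp.equivFunOnFinite.symm fun j => (β j : ℕ) := fun β β' h => by
      funext j
      exact Fin.ext (DFunLike.congr_fun h j)
    rw [hp, MvPolynomial.eval_eq']
    refine (Finset.sum_subset (s₂ := Finset.univ.image fun β : ι → Fin (D + 1) =>
        Finsupp.equivFunOnFinite.symm fun j => (β j : ℕ)) (fun d hd => ?_) (fun d _ hd => ?_)).trans
      ((Finset.sum_image fun _ _ _ _ h => hinj h).trans ?_)
    · refine Finset.mem_image.2 ⟨fun j => ⟨d j, Nat.lt_succ_of_le
        ((MvPolynomial.monomial_le_degreeOf j hd).trans (hD i j))⟩, Finset.mem_univ _, ?_⟩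
      ext j
      simp
    · rw [MvPolynomial.notMem_support_iff.1 hd, zero_mul]
    · simp [co, mon]
  let c : (ι → Fin (D + 1)) → (ι → Fin (D + 1)) → (ι → Fin (D + 1)) → ℝ := fun α β' β =>
    ∑ i, if β' = low α i then (α i : ℝ) * co β i else 0
  have hmon : ∀ t ∈ Icc 0 T, ∀ α,
      HasDerivWithinAt (mon α) (∑ β', ∑ β, c α β' β * (mon β' t * mon β t)) (Icc 0 T) t := by
    intro t ht α
    have h1 := HasDerivWithinAt.fun_finsetProd (u := Finset.univ) (x := t) (s := Icc 0 T)
      (f := fun i t => y i t ^ (α i : ℕ)) (f' := fun i => (α i : ℕ) * y i t ^ ((α i : ℕ) - 1) * g i t)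
      (fun i _ => (hy t ht i).fun_pow _)
    refine h1.congr_deriv (Eq.symm ?_)
    have hlow : ∀ i, mon (low α i) t =
        (∏ j ∈ Finset.univ.erase i, y j t ^ (α j : ℕ)) * y i t ^ ((α i : ℕ) - 1) := by
      intro i
      rw [mul_comm]
      simp only [mon, low]
      rw [← Finset.mul_prod_erase _ _ (Finset.mem_univ i)]
      congr 1
      · simp
      · refine Finset.prod_congr rfl fun j hj => ?_
        rw [Function.update_of_ne (Finset.ne_of_mem_erase hj)]
    simp only [c, Finset.sum_mul]
    rw [Finset.sum_congr rfl fun β' _ => Finset.sum_comm, Finset.sum_comm]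
    refine Finset.sum_congr rfl fun i _ => ?_
    rw [Finset.sum_eq_single (low α i) (fun β' _ h => by simp [h]) (by simp), heval, smul_eq_mul,
      ← mul_assoc, Finset.mul_sum]
    refine Finset.sum_congr rfl fun β _ => ?_
    rw [if_pos rfl, hlow]
    ring
  obtain ⟨x, hx, hxe⟩ := analytic_of_quadratic c hmon ht₀
  let one : ι → ι → Fin (D + 1) := fun i j => if j = i then ⟨1, by omega⟩ else 0
  refine ⟨fun i => x (one i), fun i => hx _, ?_⟩
  filter_upwards [hxe] with t ht i
  rw [← ht]
  simp only [mon, one]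
  rw [Finset.prod_eq_single i] <;> simp +contextual
  
end Polynomial

/-! ### Analytic diagonalization of symmetric matrices -/


/-! ### The binomial series of the inverse square root -/

section InvSqrt

theorem succ_mul_ringChoose (r : ℝ) (n : ℕ) :
    (n + 1) * Ring.choose r (n + 1) = (r - n) * Ring.choose r n := by
  have h1 := Ring.descPochhammer_eq_factorial_smul_choose r n
  have h2 := Ring.descPochhammer_eq_factorial_smul_choose r (n + 1)
  rw [descPochhammer_succ_right, Polynomial.smeval_mul, h1, Nat.factorial_succ] at h2
  simp only [Polynomial.smeval_sub, Polynomial.smeval_X, Polynomial.smeval_natCast, pow_one,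
    pow_zero, nsmul_eq_mul, mul_one, Nat.cast_mul, Nat.cast_add, Nat.cast_one] at h2
  have hf : (n.factorial : ℝ) ≠ 0 := Nat.cast_ne_zero.2 n.factorial_ne_zero
  apply mul_left_cancel₀ hf
  linear_combination -h2

/-- The ratio of consecutive coefficients has absolute value `(n + 1/2) / (n + 1) ≤ 1`. -/
theorem abs_ringChoose_neg_half_le (n : ℕ) : |Ring.choose (-1 / 2 : ℝ) n| ≤ 1 := by
  induction n with
  | zero => simp
  | succ n ih =>
    have h := succ_mul_ringChoose (-1 / 2) n
    have hn : (0 : ℝ) < n + 1 := by positivity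
    have h' := congrArg abs h
    rw [abs_mul, abs_mul, abs_of_pos hn] at h'
    have h3 : |(-1 / 2 : ℝ) - n| ≤ n + 1 := by
      rw [abs_le]; constructor <;> linarith
    have h4 : ((n : ℝ) + 1) * |Ring.choose (-1 / 2 : ℝ) (n + 1)| ≤ (n + 1) * 1 := by
      rw [h']
      gcongr
    exact le_of_mul_le_mul_left h4 hn

theorem ringChoose_neg_one (n : ℕ) : Ring.choose (-1 : ℝ) n = (-1) ^ n := by
  induction n with
  | zero => simp
  | succ n ih =>
    have h := succ_mul_ringChoose (-1) n
    have hn : (n + 1 : ℝ) ≠ 0 := by positivity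
    rw [ih] at h
    apply mul_left_cancel₀ hn
    rw [h]
    ring

variable {𝔸 : Type*} [NormedRing 𝔸] [NormedAlgebra ℝ 𝔸]

/-- The binomial series of `(1 + X) ^ (-1 / 2)` in a Banach algebra. -/
noncomputable def invSqrtOneAdd (X : 𝔸) : 𝔸 := ∑' n : ℕ, Ring.choose (-1 / 2 : ℝ) n • X ^ n

theorem summable_norm_invSqrtOneAdd {X : 𝔸} (hX : ‖X‖ < 1) :
    Summable fun n : ℕ => ‖Ring.choose (-1 / 2 : ℝ) n • X ^ n‖ := by
  refine Summable.of_nonneg_of_le (fun _ => norm_nonneg _) (fun n => ?_)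
    (summable_norm_geometric_of_norm_lt_one hX)
  rw [norm_smul]
  exact mul_le_of_le_one_left (norm_nonneg _) (abs_ringChoose_neg_half_le n)

theorem commute_invSqrtOneAdd {X Y : 𝔸} (h : Commute Y X) : Commute Y (invSqrtOneAdd X) :=
  Commute.tsum_right _ fun n => (h.pow_right n).smul_right _

variable [CompleteSpace 𝔸]

/-- By the Chu–Vandermonde identity the Cauchy square of the series has coefficients `Ring.choose
(-1) n = (-1)ⁿ`, so it is the geometric series inverting `1 + X`. -/
theorem invSqrtOneAdd_mul_self {X : 𝔸} (hX : ‖X‖ < 1) :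
    (1 + X) * (invSqrtOneAdd X * invSqrtOneAdd X) = 1 := by
  have h : invSqrtOneAdd X * invSqrtOneAdd X = ∑' n : ℕ, (-X) ^ n := by
    rw [invSqrtOneAdd, tsum_mul_tsum_eq_tsum_sum_antidiagonal_of_summable_norm
      (summable_norm_invSqrtOneAdd hX) (summable_norm_invSqrtOneAdd hX)]
    refine tsum_congr fun n => ?_
    have hc : ∑ p ∈ Finset.HasAntidiagonal.antidiagonal n,
        Ring.choose (-1 / 2 : ℝ) p.1 * Ring.choose (-1 / 2 : ℝ) p.2 = (-1) ^ n := by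
      rw [← ringChoose_neg_one, ← Ring.add_choose_eq n (Commute.all _ _)]
      norm_num
    calc _ = ∑ p ∈ Finset.HasAntidiagonal.antidiagonal n,
          (Ring.choose (-1 / 2 : ℝ) p.1 * Ring.choose (-1 / 2 : ℝ) p.2) • X ^ n := by
          refine Finset.sum_congr rfl fun p hp => ?_
          rw [smul_mul_smul_comm, ← pow_add, Finset.HasAntidiagonal.mem_antidiagonal.1 hp]
      _ = _ := by rw [← Finset.sum_smul, hc, ← neg_one_smul ℝ X, smul_pow]
  rw [h, ← sub_neg_eq_add]
  exact mul_neg_geom_series (-X) (by rwa [norm_neg])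

theorem invSqrtOneAdd_pos {x : ℝ} (hx : |x| < 1) : 0 < invSqrtOneAdd x := by
  have h := Real.one_add_rpow_hasFPowerSeriesOnBall_zero (a := -1 / 2)
  have hs := h.hasSum (y := x) (by
    rw [Metric.mem_eball, edist_zero_right, ← ofReal_norm, ENNReal.ofReal_lt_one]
    assumption)
  rw [zero_add] at hs
  have : invSqrtOneAdd x = (1 + x) ^ (-1 / 2 : ℝ) := by
    rw [← hs.tsum_eq]
    refine tsum_congr fun n => ?_
    simp only [binomialSeries_apply, List.ofFn_const, List.prod_replicate]
  rw [this]
  exact Real.rpow_pos_of_pos (by linarith [(abs_lt.1 hx).1]) _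

theorem analyticAt_invSqrtOneAdd {X : 𝔸} (hX : ‖X‖ < 1) :
    AnalyticAt ℝ (invSqrtOneAdd : 𝔸 → 𝔸) X := by
  set p := FormalMultilinearSeries.ofScalars 𝔸 (fun n => Ring.choose (-1 / 2 : ℝ) n) with hp
  have hr : 1 ≤ p.radius := by
    refine FormalMultilinearSeries.le_radius_of_bound _ (max 1 ‖p 0‖) (r := 1) fun n => ?_
    rw [NNReal.coe_one, one_pow, mul_one]
    rcases Nat.eq_zero_or_pos n with rfl | hn
    · exact le_max_right _ _
    · exact ((FormalMultilinearSeries.ofScalars_norm_le _ _ _ hn).trans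
        (abs_ringChoose_neg_half_le n)).trans (le_max_left _ _)
  have h := FormalMultilinearSeries.hasFPowerSeriesOnBall p (lt_of_lt_of_le one_pos hr)
  have h2 : AnalyticAt ℝ p.sum X := h.analyticAt_of_mem (Metric.eball_subset_eball hr (by
    rw [Metric.mem_eball, edist_zero_right, ← ofReal_norm, ENNReal.ofReal_lt_one]
    assumption))
  refine h2.congr (Eventually.of_forall fun Y => ?_)
  simp only [FormalMultilinearSeries.sum, hp, FormalMultilinearSeries.ofScalars_apply_eq]
  rfl

/-- Evaluates the series on an eigenvector, encoded as an algebra element `V`. Together with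
`invSqrtOneAdd_pos` this identifies the sign of the spectral values of the matrix sign function. -/
theorem invSqrtOneAdd_mul_of_mul_eq_smul {X V : 𝔸} {x : ℝ} (hX : ‖X‖ < 1) (hx : |x| < 1)
    (h : X * V = x • V) : invSqrtOneAdd X * V = invSqrtOneAdd x • V := by
  have hpow : ∀ n : ℕ, X ^ n * V = x ^ n • V := by
    intro n
    induction n with
    | zero => simp
    | succ n ih => rw [pow_succ, mul_assoc, h, mul_smul_comm, ih, smul_smul, pow_succ, mul_comm]
  rw [invSqrtOneAdd, ← (summable_norm_invSqrtOneAdd hX).of_norm.tsum_mul_right, invSqrtOneAdd,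
    ← (summable_norm_invSqrtOneAdd (X := x) hx).of_norm.tsum_smul_const]
  refine tsum_congr fun n => ?_
  rw [smul_mul_assoc, hpow, smul_smul, smul_eq_mul]

end InvSqrt

/-! ### The matrix sign function -/

section Sign

open scoped Matrix.Norms.L2Operator

variable {n : Type*} [Fintype n] [DecidableEq n]

theorem transpose_invSqrtOneAdd (X : Matrix n n ℝ) :
    (invSqrtOneAdd X).transpose = invSqrtOneAdd X.transpose := by
  rw [invSqrtOneAdd, Matrix.transpose_tsum, invSqrtOneAdd]
  simp [Matrix.transpose_smul, Matrix.transpose_pow]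

/-- The sign of an analytic family of invertible symmetric matrices is analytic. -/
theorem exists_analytic_sign {H : ℝ → Matrix n n ℝ} {t₀ α : ℝ} (hH : AnalyticAt ℝ H t₀)
    (hα : 0 < α) (hnorm : ‖α⁻¹ • (H t₀ * H t₀) - 1‖ < 1) :
    ∃ S : ℝ → Matrix n n ℝ, AnalyticAt ℝ S t₀ ∧
      (∀ᶠ t in 𝓝 t₀, S t * S t = 1) ∧
      (∀ t, (H t).transpose = H t → (S t).transpose = S t) ∧
      (∀ t Y, Commute Y (H t) → Commute Y (S t)) ∧
      ∀ (V : Matrix n n ℝ) (μ : ℝ), V ≠ 0 → H t₀ * V = μ • V →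
        ∃ ρ : ℝ, 0 < ρ ∧ S t₀ * V = (μ * ρ) • V := by
  set X : ℝ → Matrix n n ℝ := fun t => α⁻¹ • (H t * H t) - 1 with hX
  have hXa : AnalyticAt ℝ X t₀ := by
    have := hH.fun_mul hH
    exact (AnalyticAt.fun_const_smul (c := α⁻¹) this).fun_sub analyticAt_const
  have hcomm : ∀ t, ∀ Y, Commute Y (H t) → Commute Y (X t) := fun t Y h =>
    ((h.mul_right h).smul_right _).sub_right (Commute.one_right _)
  -- This is `H (H²)^(-1/2)`, rescaled by `α` to bring `H² / α = 1 + X` into the domain of the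
  -- binomial series.
  refine ⟨fun t => (√α)⁻¹ • (H t * invSqrtOneAdd (X t)), ?_, ?_, ?_, ?_, ?_⟩
  · have h1 : AnalyticAt ℝ (fun t => invSqrtOneAdd (X t)) t₀ :=
      AnalyticAt.fun_comp (g := invSqrtOneAdd) (analyticAt_invSqrtOneAdd hnorm) hXa
    exact AnalyticAt.fun_const_smul (hH.fun_mul h1)
  · have hlt : ∀ᶠ t in 𝓝 t₀, ‖X t‖ < 1 :=
      hXa.continuousAt.norm.eventually_lt continuousAt_const hnorm
    filter_upwards [hlt] with t ht
    have hc : Commute (H t) (invSqrtOneAdd (X t)) :=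
      commute_invSqrtOneAdd (hcomm t _ (Commute.refl _))
    have h1 := invSqrtOneAdd_mul_self ht
    have h2 : 1 + X t = α⁻¹ • (H t * H t) := by simp [hX]
    rw [h2] at h1
    rw [smul_mul_smul_comm, ← mul_inv, Real.mul_self_sqrt hα.le, ← h1, smul_mul_assoc,
      hc.mul_mul_mul_comm]
  · intro t ht
    have hc : Commute (H t) (invSqrtOneAdd (X t)) :=
      commute_invSqrtOneAdd (hcomm t _ (Commute.refl _))
    rw [Matrix.transpose_smul, Matrix.transpose_mul, transpose_invSqrtOneAdd, ht]
    have : (X t).transpose = X t := by simp [hX, Matrix.transpose_mul, ht]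
    simp only [this, hc.eq]
  · intro t Y hY
    exact (hY.mul_right (commute_invSqrtOneAdd (hcomm t Y hY))).smul_right _
  · intro V μ hV hHV
    have hXV : X t₀ * V = (α⁻¹ * (μ * μ) - 1) • V := by
      simp only [hX]
      rw [sub_mul, smul_mul_assoc, mul_assoc, hHV, mul_smul_comm, hHV, one_mul, smul_smul,
        sub_smul, one_smul, smul_smul, mul_assoc]
    have hx : |α⁻¹ * (μ * μ) - 1| < 1 := by
      have h1 := norm_mul_le (X t₀) V
      rw [hXV, norm_smul, Real.norm_eq_abs] at h1
      exact lt_of_le_of_lt (le_of_mul_le_mul_right h1 (norm_pos_iff.2 hV)) hnorm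
    refine ⟨(√α)⁻¹ * invSqrtOneAdd (α⁻¹ * (μ * μ) - 1),
      mul_pos (by positivity) (invSqrtOneAdd_pos hx), ?_⟩
    rw [smul_mul_assoc, mul_assoc, invSqrtOneAdd_mul_of_mul_eq_smul hnorm hx hXV, mul_smul_comm,
      hHV, smul_smul, smul_smul]
    congr 1
    ring

end Sign

/-! ### Splitting into analytic spectral projections -/

section Projections

open scoped Matrix.Norms.L2Operator

variable {n : Type*} [Fintype n] [DecidableEq n]

/-- Once `α` exceeds every `(λ_i - c)²`, the spectrum of the scaled square lies in `(0, 1)`: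
positive because `c` is not an eigenvalue. The operator norm is computed after unitary
diagonalization. -/
theorem exists_norm_smul_sq_sub_one_lt {B : Matrix n n ℝ} (hB : B.IsHermitian) {c : ℝ}
    (hc : ∀ i, hB.eigenvalues i ≠ c) :
    ∃ α : ℝ, 0 < α ∧ ‖α⁻¹ • ((B - c • 1) * (B - c • 1)) - 1‖ < 1 := by
  set φ := Unitary.conjStarAlgAut ℝ (Matrix n n ℝ) hB.eigenvectorUnitary with hφ
  have hspec : B = φ (Matrix.diagonal hB.eigenvalues) := hB.spectral_theorem
  have hnorm : ∀ X, ‖φ X‖ = ‖X‖ := fun X => by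
    rw [hφ, Unitary.conjStarAlgAut_apply, ← Unitary.coe_star, CStarRing.norm_mul_coe_unitary,
      CStarRing.norm_coe_unitary_mul]
  set α : ℝ := ∑ i, (hB.eigenvalues i - c) ^ 2 + 1 with hα
  have hα0 : 0 < α := by positivity
  refine ⟨α, hα0, ?_⟩
  have h1 : α⁻¹ • ((B - c • 1) * (B - c • 1)) - 1 =
      φ (Matrix.diagonal fun i => α⁻¹ * (hB.eigenvalues i - c) ^ 2 - 1) := by
    have h2 : (Matrix.diagonal fun i => α⁻¹ * (hB.eigenvalues i - c) ^ 2 - 1) =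
        α⁻¹ • ((Matrix.diagonal hB.eigenvalues - c • 1) * (Matrix.diagonal hB.eigenvalues - c • 1))
          - 1 := by
      ext i j
      rcases eq_or_ne i j with rfl | hij
      · simp [← Matrix.diagonal_one, ← Matrix.diagonal_smul, pow_two]
      · simp [← Matrix.diagonal_one, ← Matrix.diagonal_smul, hij]
    rw [h2, map_sub, map_smul, map_mul, map_sub, map_smul, map_one, ← hspec]
  rw [h1, hnorm, Matrix.l2_opNorm_diagonal, pi_norm_lt_iff one_pos]
  intro i
  have h3 : (hB.eigenvalues i - c) ^ 2 < α := by
    have := Finset.single_le_sum (f := fun i => (hB.eigenvalues i - c) ^ 2)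
      (fun _ _ => sq_nonneg _) (Finset.mem_univ i)
    rw [hα]
    linarith
  have h4 : 0 < (hB.eigenvalues i - c) ^ 2 := by
    have := sub_ne_zero.2 (hc i)
    positivity
  have h5 : α⁻¹ * (hB.eigenvalues i - c) ^ 2 < 1 := by
    rwa [inv_mul_lt_iff₀ hα0, mul_one]
  have h6 : 0 < α⁻¹ * (hB.eigenvalues i - c) ^ 2 := by positivity
  rw [Real.norm_eq_abs, abs_lt]
  constructor <;> linarith

theorem exists_eigenvalues_of_trace_eq_zero {B : Matrix n n ℝ} (hB : B.IsHermitian)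
    (hB0 : B ≠ 0) (htr : B.trace = 0) :
    ∃ i j, 0 < hB.eigenvalues i ∧ hB.eigenvalues j < 0 := by
  have hsum : ∑ i, hB.eigenvalues i = 0 := by
    have := hB.trace_eq_sum_eigenvalues
    rw [htr] at this
    simpa using this.symm
  have hne : ∃ i, hB.eigenvalues i ≠ 0 := by
    by_contra! h
    exact hB0 (hB.eigenvalues_eq_zero_iff.1 (funext h))
  obtain ⟨i, _, hi⟩ := Finset.exists_pos_of_sum_zero_of_exists_nonzero hB.eigenvalues hsum
    (by simpa using hne)
  obtain ⟨j, _, hj⟩ := Finset.exists_pos_of_sum_zero_of_exists_nonzero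
    (s := Finset.univ) (fun i => -hB.eigenvalues i) (by simp [hsum]) (by simpa using hne)
  exact ⟨i, j, hi, by linarith⟩

theorem exists_eigenmatrix {B : Matrix n n ℝ} (hB : B.IsHermitian) (i : n) :
    ∃ V : Matrix n n ℝ, V ≠ 0 ∧ B * V = hB.eigenvalues i • V := by
  set w : n → ℝ := ⇑(hB.eigenvectorBasis i) with hw
  have hw0 : w ≠ 0 := by
    intro h
    have := hB.eigenvectorBasis.orthonormal.ne_zero i
    exact this (by ext k; exact congrFun h k)
  obtain ⟨k, hk⟩ := Function.ne_iff.1 hw0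
  refine ⟨Matrix.vecMulVec w w, fun h => ?_, ?_⟩
  · have := congrFun (congrFun h k) k
    simp [Matrix.vecMulVec] at this
    exact hk this
  · rw [Matrix.mul_vecMulVec, hB.mulVec_eigenvectorBasis, Matrix.smul_vecMulVec]

/-- The trace of an idempotent is its rank; this natural number is the measure for the induction on
projections. -/
theorem exists_natCast_eq_trace {P : Matrix n n ℝ} (hP : P * P = P) :
    ∃ r : ℕ, P.trace = r ∧ (r = 0 → P = 0) := by
  have hidem : IsIdempotentElem (Matrix.toLin' P) := by
    rw [IsIdempotentElem, Module.End.mul_eq_comp, ← Matrix.toLin'_mul, hP]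
  have h := (LinearMap.IsIdempotentElem.isProj_range _ hidem).trace
  rw [Matrix.trace_toLin'_eq] at h
  refine ⟨_, h, fun h0 => ?_⟩
  rw [h0, Nat.cast_zero, ← Matrix.trace_toLin'_eq] at h
  exact (LinearEquiv.map_eq_zero_iff _).1 (LinearMap.IsIdempotentElem.eq_zero_of_trace_eq_zero hidem h)

/-- An analytic projection that commutes with an analytic symmetric matrix, which is not a multiple
of the projection, splits into two analytic projections. -/
theorem exists_analytic_splitting {P B : ℝ → Matrix n n ℝ} {t₀ : ℝ} (hP : AnalyticAt ℝ P t₀)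
    (hPP : ∀ᶠ t in 𝓝 t₀, P t * P t = P t ∧ (P t).transpose = P t)
    (hB : AnalyticAt ℝ B t₀)
    (hBP : ∀ᶠ t in 𝓝 t₀, (B t).transpose = B t ∧ P t * B t = B t)
    (hB0 : B t₀ ≠ 0) (htr : (B t₀).trace = 0) :
    ∃ P₁ P₂ : ℝ → Matrix n n ℝ, AnalyticAt ℝ P₁ t₀ ∧ AnalyticAt ℝ P₂ t₀ ∧
      P₁ t₀ ≠ 0 ∧ P₂ t₀ ≠ 0 ∧
      ∀ᶠ t in 𝓝 t₀, P₁ t * P₁ t = P₁ t ∧ P₂ t * P₂ t = P₂ t ∧ (P₁ t).transpose = P₁ t ∧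
        (P₂ t).transpose = P₂ t ∧ P₁ t * P₂ t = 0 ∧ P₁ t + P₂ t = P t ∧
        P₁ t * B t = B t * P₁ t ∧ P₂ t * B t = B t * P₂ t := by
  have hH0 : (B t₀).IsHermitian := by
    rw [Matrix.IsHermitian, Matrix.conjTranspose_eq_transpose_of_trivial]
    exact hBP.self_of_nhds.1
  have hPB0 := hBP.self_of_nhds.2
  obtain ⟨i, j, hi, hj⟩ := exists_eigenvalues_of_trace_eq_zero hH0 hB0 htr
  -- The threshold `c` separates a positive eigenvalue from a negative one and misses the spectrum,
  -- so `B - c` is invertible at `t₀` and has an analytic sign `S`. The pieces are `P (1 ± S) / 2`;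
  -- both are nonzero since eigenvectors with nonzero eigenvalue lie in the range of `P`.
  obtain ⟨c, hc, hcne⟩ : ∃ c ∈ Ioo 0 (hH0.eigenvalues i), c ∉ range hH0.eigenvalues :=
    ((Ioo_infinite hi).sdiff (finite_range _)).nonempty
  obtain ⟨α, hα, hnorm⟩ := exists_norm_smul_sq_sub_one_lt hH0 (c := c)
    (fun k hk => hcne ⟨k, hk⟩)
  obtain ⟨S, hSa, hSS, hSt, hSc, hSV⟩ := exists_analytic_sign (H := fun t => B t - c • 1)
    (hB.fun_sub analyticAt_const) hα hnorm
  obtain ⟨V, hV, hBV⟩ := exists_eigenmatrix hH0 i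
  obtain ⟨W, hW, hBW⟩ := exists_eigenmatrix hH0 j
  have hrange : ∀ (U : Matrix n n ℝ) (μ : ℝ), μ ≠ 0 → B t₀ * U = μ • U → P t₀ * U = U := by
    intro U μ hμ hU
    have h1 : P t₀ * (B t₀ * U) = B t₀ * U := by rw [← mul_assoc, hPB0]
    rw [hU, mul_smul_comm] at h1
    exact smul_right_injective _ hμ h1
  have hsign : ∀ (U : Matrix n n ℝ) (μ : ℝ), U ≠ 0 → B t₀ * U = μ • U →
      ∃ ρ : ℝ, 0 < ρ ∧ S t₀ * U = ((μ - c) * ρ) • U := fun U μ hU hBU =>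
    hSV U (μ - c) hU (by rw [sub_mul, hBU, smul_mul_assoc, one_mul, sub_smul])
  have ha : ∀ s : ℝ, AnalyticAt ℝ (fun t => (1 / 2 : ℝ) • (P t * (1 + s • S t))) t₀ := fun s =>
    AnalyticAt.fun_const_smul (hP.fun_mul (analyticAt_const.fun_add
      (AnalyticAt.fun_const_smul hSa)))
  have hne : ∀ (s μ : ℝ) (U : Matrix n n ℝ), μ ≠ 0 → U ≠ 0 → B t₀ * U = μ • U → 0 < s * (μ - c) →
      (1 / 2 : ℝ) • (P t₀ * (1 + s • S t₀)) ≠ 0 := by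
    intro s μ U hμ hU hBU hpos h
    obtain ⟨ρ, hρ, hSU⟩ := hsign U μ hU hBU
    have h1 : (1 / 2 : ℝ) • (P t₀ * (1 + s • S t₀)) * U = ((1 / 2) * (1 + s * (μ - c) * ρ)) • U := by
      rw [smul_mul_assoc, mul_assoc, add_mul, one_mul, smul_mul_assoc, hSU, smul_smul,
        mul_add, mul_smul_comm, hrange U μ hμ hBU]
      module
    rw [h, zero_mul] at h1
    have h2 : 0 < s * (μ - c) * ρ := mul_pos hpos hρ
    exact (smul_ne_zero (by positivity) hU) h1.symm
  refine ⟨fun t => (1 / 2 : ℝ) • (P t * (1 + (1 : ℝ) • S t)),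
    fun t => (1 / 2 : ℝ) • (P t * (1 + (-1 : ℝ) • S t)), ha 1, ha (-1),
    hne 1 _ V hi.ne' hV hBV (by linarith [hc.2]), hne (-1) _ W hj.ne hW hBW (by linarith [hc.1]), ?_⟩
  filter_upwards [hPP, hBP, hSS] with t hPt hBt hSSt
  have hBPt : B t * P t = B t := by
    have := congrArg Matrix.transpose hBt.2
    rwa [Matrix.transpose_mul, hBt.1, hPt.2] at this
  have hPBc : Commute (P t) (B t) := by rw [Commute, SemiconjBy, hBt.2, hBPt]
  have hcc : ∀ Y, Commute Y (B t) → Commute Y (S t) := fun Y hY =>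
    hSc t Y (hY.sub_right ((Commute.one_right _).smul_right _))
  have hPS := (hcc _ hPBc).eq
  have hBS := (hcc _ (Commute.refl (B t))).eq
  have hStt := hSt t (by simp [hBt.1])
  have hPPS : P t * (P t * S t) = P t * S t := by rw [← mul_assoc, hPt.1]
  have hSPS : S t * (P t * S t) = P t := by rw [← mul_assoc, ← hPS, mul_assoc, hSSt, mul_one]
  have hSP : S t * P t = P t * S t := hPS.symm
  have hPSP : P t * S t * P t = P t * S t := by rw [mul_assoc, hSP, hPPS]
  have hPSPS : P t * S t * (P t * S t) = P t := by rw [mul_assoc, hSPS, hPt.1]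
  have hBPS : B t * (P t * S t) = B t * S t := by rw [← mul_assoc, hBPt]
  have hPSB : P t * S t * B t = B t * S t := by rw [mul_assoc, ← hBS, ← mul_assoc, hBt.2]
  have key : ∀ s s' : ℝ, (1 / 2 : ℝ) • (P t * (1 + s • S t)) * ((1 / 2 : ℝ) • (P t * (1 + s' • S t)))
      = (1 / 4 : ℝ) • ((1 + s * s') • P t + (s + s') • (P t * S t)) := by
    intro s s'
    simp only [mul_add, mul_one, mul_smul_comm, smul_mul_assoc, add_mul, smul_add, hPt.1, hPPS,
      hPSP, hPSPS]
    module
  have hmulP : ∀ s : ℝ, P t * (1 + s • S t) = P t + s • (P t * S t) := fun s => by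
    rw [mul_add, mul_one, mul_smul_comm]
  have htrans : ∀ s : ℝ, ((1 / 2 : ℝ) • (P t * (1 + s • S t))).transpose =
      (1 / 2 : ℝ) • (P t * (1 + s • S t)) := by
    intro s
    simp [Matrix.transpose_mul, hStt, hPt.2, mul_add, hSP]
  have hcomm : ∀ s : ℝ, (1 / 2 : ℝ) • (P t * (1 + s • S t)) * B t =
      B t * ((1 / 2 : ℝ) • (P t * (1 + s • S t))) := by
    intro s
    simp only [mul_add, mul_one, mul_smul_comm, smul_mul_assoc, add_mul, smul_add, hBt.2, hBPt,
      hPSB, hBPS]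
  refine ⟨?_, ?_, htrans _, htrans _, ?_, ?_, hcomm _, hcomm _⟩
  · rw [key, hmulP]; module
  · rw [key, hmulP]; module
  · rw [key]; module
  · rw [hmulP, hmulP]; module

/-- Away from `t₀` the power cancels, and the identity theorem restores equality at `t₀`. This
transfers identities to the analytic quotient by `(t - t₀)^m`. -/
theorem eventually_eq_of_pow_smul_eq {E : Type*} [NormedAddCommGroup E] [NormedSpace ℝ E]
    {φ ψ : ℝ → E} {t₀ : ℝ} {m : ℕ} (hφ : AnalyticAt ℝ φ t₀) (hψ : AnalyticAt ℝ ψ t₀)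
    (h : ∀ᶠ t in 𝓝 t₀, (t - t₀) ^ m • φ t = (t - t₀) ^ m • ψ t) : ∀ᶠ t in 𝓝 t₀, φ t = ψ t := by
  refine (hφ.frequently_eq_iff_eventually_eq hψ).1 (Eventually.frequently ?_)
  filter_upwards [h.filter_mono nhdsWithin_le_nhds, self_mem_nhdsWithin] with t ht hne
  exact smul_right_injective _ (pow_ne_zero m (sub_ne_zero.2 hne)) ht

/-- Induction on the rank of `P`, as in Rellich's theorem. A projection of rank at least two is
split by the sign of a traceless symmetric matrix `B` with `B t₀ ≠ 0`. At an eigenvalue crossing the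
traceless part of `A P` may vanish, but analyticity allows division by the right power of `t - t₀`.
-/
theorem exists_analytic_projections {A : ℝ → Matrix n n ℝ} {t₀ : ℝ} (hA : AnalyticAt ℝ A t₀)
    (hAs : ∀ᶠ t in 𝓝 t₀, (A t).transpose = A t) (r : ℕ) : ∀ P : ℝ → Matrix n n ℝ,
    AnalyticAt ℝ P t₀ →
    (∀ᶠ t in 𝓝 t₀, P t * P t = P t ∧ (P t).transpose = P t ∧ A t * P t = P t * A t) →
    (P t₀).trace = r →
    ∃ (ι : Type) (_ : Fintype ι) (Q : ι → ℝ → Matrix n n ℝ), Fintype.card ι = r ∧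
      (∀ i, AnalyticAt ℝ (Q i) t₀ ∧ Q i t₀ ≠ 0) ∧
      ∀ᶠ t in 𝓝 t₀, (∀ i, Q i t * Q i t = Q i t ∧ (Q i t).transpose = Q i t ∧
        A t * Q i t = Q i t * A t ∧ P t * Q i t = Q i t) ∧ ∀ i j, i ≠ j → Q i t * Q j t = 0 := by
  induction r using Nat.strong_induction_on with
  | _ r ih =>
  intro P hP hPP htr
  rcases Nat.lt_or_ge r 2 with hr | hr
  · interval_cases r
    · exact ⟨Empty, inferInstance, fun i => i.elim, rfl, fun i => i.elim,
        Eventually.of_forall fun t => ⟨fun i => i.elim, fun i => i.elim⟩⟩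
    · refine ⟨Unit, inferInstance, fun _ => P, rfl, fun _ => ⟨hP, fun h => ?_⟩, ?_⟩
      · simp [h] at htr
      · filter_upwards [hPP] with t ht
        exact ⟨fun _ => ⟨ht.1, ht.2.1, ht.2.2, ht.1⟩, fun i j h => (h rfl).elim⟩
  have hr0 : (P t₀).trace ≠ 0 := by
    rw [htr]
    positivity
  have htrace : ∀ {C : ℝ → Matrix n n ℝ}, AnalyticAt ℝ C t₀ →
      AnalyticAt ℝ (fun t => (C t).trace) t₀ := fun hC =>
    ((LinearMap.toContinuousLinearMap (Matrix.traceLinearMap n ℝ ℝ)).analyticAt _).comp hC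
  have htrP : ∀ᶠ t in 𝓝 t₀, (P t).trace ≠ 0 :=
    (htrace hP).continuousAt.eventually_ne hr0
  -- the traceless part of a family dominated by `P`
  let F : (ℝ → Matrix n n ℝ) → ℝ → Matrix n n ℝ := fun C t =>
    C t - ((C t).trace / (P t).trace) • P t
  have hF : ∀ {C}, AnalyticAt ℝ C t₀ → AnalyticAt ℝ (F C) t₀ := fun hC =>
    hC.fun_sub (((htrace hC).fun_div (htrace hP) hr0).fun_smul hP)
  have hFtr : ∀ C, ∀ᶠ t in 𝓝 t₀, (F C t).trace = 0 := fun C => by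
    filter_upwards [htrP] with t ht
    simp only [F, Matrix.trace_sub, Matrix.trace_smul, smul_eq_mul]
    field_simp
    ring
  -- Everything reduces to a splitting matrix `B` such that whatever commutes with `B` inside the
  -- range of `P` also commutes with `A`; the two pieces then have smaller rank and the induction
  -- applies to each.
  suffices h : ∃ B : ℝ → Matrix n n ℝ, AnalyticAt ℝ B t₀ ∧ B t₀ ≠ 0 ∧ (B t₀).trace = 0 ∧
      (∀ᶠ t in 𝓝 t₀, (B t).transpose = B t ∧ P t * B t = B t) ∧
      ∀ᶠ t in 𝓝 t₀, ∀ Y, Y * P t = Y → P t * Y = Y → Y * B t = B t * Y → A t * Y = Y * A t by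
    obtain ⟨B, hB, hB0, hBtr, hBP, hBA⟩ := h
    obtain ⟨P₁, P₂, hP₁, hP₂, hP₁0, hP₂0, hsplit⟩ := exists_analytic_splitting hP
      (hPP.mono fun t ht => ⟨ht.1, ht.2.1⟩) hB hBP hB0 hBtr
    have h0 := hsplit.self_of_nhds
    obtain ⟨r₁, hr₁, hr₁0⟩ := exists_natCast_eq_trace h0.1
    obtain ⟨r₂, hr₂, hr₂0⟩ := exists_natCast_eq_trace h0.2.1
    have hr₁' : r₁ ≠ 0 := fun h => hP₁0 (hr₁0 h)
    have hr₂' : r₂ ≠ 0 := fun h => hP₂0 (hr₂0 h)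
    have hsum : r₁ + r₂ = r := by
      have : (P₁ t₀).trace + (P₂ t₀).trace = (P t₀).trace := by
        rw [← Matrix.trace_add, h0.2.2.2.2.2.1]
      rw [hr₁, hr₂, htr] at this
      exact_mod_cast this
    have hfull : ∀ᶠ t in 𝓝 t₀, (P₁ t * P₁ t = P₁ t ∧ (P₁ t).transpose = P₁ t ∧
        A t * P₁ t = P₁ t * A t) ∧ (P₂ t * P₂ t = P₂ t ∧ (P₂ t).transpose = P₂ t ∧
        A t * P₂ t = P₂ t * A t) ∧ P t * P₁ t = P₁ t ∧ P t * P₂ t = P₂ t ∧ P₁ t * P₂ t = 0 := by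
      filter_upwards [hsplit, hBA] with t ht hAt
      obtain ⟨h11, h22, h1t, h2t, h12, hadd, h1B, h2B⟩ := ht
      have h21 : P₂ t * P₁ t = 0 := by
        have := congrArg Matrix.transpose h12
        rwa [Matrix.transpose_mul, h1t, h2t, Matrix.transpose_zero] at this
      have hP1 : P t * P₁ t = P₁ t := by rw [← hadd, add_mul, h11, h21, add_zero]
      have hP2 : P t * P₂ t = P₂ t := by rw [← hadd, add_mul, h22, h12, zero_add]
      have h1P : P₁ t * P t = P₁ t := by rw [← hadd, mul_add, h11, h12, add_zero]
      have h2P : P₂ t * P t = P₂ t := by rw [← hadd, mul_add, h22, h21, zero_add]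
      exact ⟨⟨h11, h1t, hAt _ h1P hP1 h1B⟩, ⟨h22, h2t, hAt _ h2P hP2 h2B⟩, hP1, hP2, h12⟩
    obtain ⟨ι₁, _, Q₁, hc₁, hQ₁, hQ₁'⟩ := ih r₁ (by omega) P₁ hP₁
      (hfull.mono fun t ht => ht.1) hr₁
    obtain ⟨ι₂, _, Q₂, hc₂, hQ₂, hQ₂'⟩ := ih r₂ (by omega) P₂ hP₂
      (hfull.mono fun t ht => ht.2.1) hr₂
    refine ⟨ι₁ ⊕ ι₂, inferInstance, Sum.elim Q₁ Q₂, by simp [hc₁, hc₂, hsum], ?_, ?_⟩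
    · rintro (i | i)
      · exact hQ₁ i
      · exact hQ₂ i
    · filter_upwards [hfull, hQ₁', hQ₂'] with t ht h1 h2
      obtain ⟨⟨-, hP₁t, -⟩, ⟨-, hP₂t, -⟩, hPP₁, hPP₂, hP₁₂⟩ := ht
      have hcross : ∀ i j, Q₁ i t * Q₂ j t = 0 := by
        intro i j
        have h3 : Q₁ i t * P₁ t = Q₁ i t := by
          have := congrArg Matrix.transpose (h1.1 i).2.2.2
          rwa [Matrix.transpose_mul, (h1.1 i).2.1, hP₁t] at this
        rw [← h3, ← (h2.1 j).2.2.2, mul_assoc, ← mul_assoc (P₁ t), hP₁₂, zero_mul, mul_zero]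
      refine ⟨?_, ?_⟩
      · rintro (i | i)
        · obtain ⟨ha, hb, hc, hd⟩ := h1.1 i
          refine ⟨ha, hb, hc, ?_⟩
          simp only [Sum.elim_inl]
          rw [← hd, ← mul_assoc, hPP₁]
        · obtain ⟨ha, hb, hc, hd⟩ := h2.1 i
          refine ⟨ha, hb, hc, ?_⟩
          simp only [Sum.elim_inr]
          rw [← hd, ← mul_assoc, hPP₂]
      · rintro (i | i) (j | j) hij
        · exact h1.2 i j fun h => hij (by rw [h])
        · exact hcross i j
        · have := congrArg Matrix.transpose (hcross j i)
          rwa [Matrix.transpose_mul, (h1.1 j).2.1, (h2.1 i).2.1, Matrix.transpose_zero] at this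
        · exact h2.2 i j fun h => hij (by rw [h])
  have hAP : AnalyticAt ℝ (fun t => A t * P t) t₀ := hA.fun_mul hP
  have hFP : ∀ C : ℝ → Matrix n n ℝ, (∀ᶠ t in 𝓝 t₀, (C t).transpose = C t ∧ P t * C t = C t) →
      ∀ᶠ t in 𝓝 t₀, (F C t).transpose = F C t ∧ P t * F C t = F C t := by
    intro C hC
    filter_upwards [hC, hPP] with t hCt hPt
    constructor
    · simp only [F, Matrix.transpose_sub, Matrix.transpose_smul, hCt.1, hPt.2.1]
    · simp only [F, mul_sub, mul_smul_comm, hCt.2, hPt.1]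
  have hAPP : ∀ᶠ t in 𝓝 t₀, (A t * P t).transpose = A t * P t ∧ P t * (A t * P t) = A t * P t := by
    filter_upwards [hPP, hAs] with t hPt hAt
    constructor
    · rw [Matrix.transpose_mul, hAt, hPt.2.1, hPt.2.2]
    · rw [hPt.2.2, ← mul_assoc, hPt.1]
  by_cases hzero : ∀ᶠ t in 𝓝 t₀, F (fun t => A t * P t) t = 0
  -- Here `A` is scalar on the range of `P`, so any splitting serves. The compression `P E P` of a
  -- diagonal matrix unit has rank one, so it cannot be a multiple of `P`, whose rank is at least
  -- two; its traceless part is nonzero.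
  · obtain ⟨l, hl⟩ : ∃ l, P t₀ l l ≠ 0 := by
      by_contra! h
      exact hr0 (Finset.sum_eq_zero fun i _ => h i)
    set E : Matrix n n ℝ := Matrix.single l l 1 with hE
    have hC : AnalyticAt ℝ (fun t => P t * E * P t) t₀ :=
      (hP.fun_mul analyticAt_const).fun_mul hP
    have hCP : ∀ᶠ t in 𝓝 t₀, (P t * E * P t).transpose = P t * E * P t ∧
        P t * (P t * E * P t) = P t * E * P t := by
      filter_upwards [hPP] with t hPt
      constructor
      · rw [Matrix.transpose_mul, Matrix.transpose_mul, hPt.2.1, hE, Matrix.transpose_single,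
          mul_assoc]
      · rw [← mul_assoc, ← mul_assoc, hPt.1]
    refine ⟨F fun t => P t * E * P t, hF hC, fun h => ?_,
      (hFtr fun t => P t * E * P t).self_of_nhds, hFP _ hCP, ?_⟩
    · have hP0 := hPP.self_of_nhds.1
      have htrD : (P t₀ * E * P t₀).trace = P t₀ l l := by
        rw [Matrix.trace_mul_comm, ← mul_assoc, hP0, Matrix.trace_mul_comm, hE,
          Matrix.trace_single_mul]
        simp
      have hEPE : E * P t₀ * E = P t₀ l l • E := by
        rw [hE, Matrix.single_mul_mul_single]
        simp
      have hD : P t₀ * E * P t₀ = (P t₀ l l / r) • P t₀ := by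
        rw [← htrD, ← htr]
        exact sub_eq_zero.1 h
      have hDD : (P t₀ * E * P t₀) * (P t₀ * E * P t₀) = P t₀ l l • (P t₀ * E * P t₀) := by
        calc _ = P t₀ * (E * (P t₀ * P t₀) * E) * P t₀ := by simp only [mul_assoc]
          _ = _ := by rw [hP0, hEPE, mul_smul_comm, smul_mul_assoc]
      rw [hD, smul_mul_smul_comm, hP0, smul_smul] at hDD
      have hPne : P t₀ ≠ 0 := fun h => hr0 (by rw [h, Matrix.trace_zero])
      have hq := smul_left_injective ℝ hPne hDD
      have hr' : (r : ℝ) ≠ 0 := by positivity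
      field_simp at hq
      have : (r : ℝ) = 1 := hq.symm
      norm_cast at this
      omega
    · filter_upwards [hzero, hPP] with t ht hPt Y hYP hPY _
      have hs : A t * P t = ((A t * P t).trace / (P t).trace) • P t := sub_eq_zero.1 ht
      calc A t * Y = (A t * P t) * Y := by rw [mul_assoc, hPY]
        _ = Y * (A t * P t) := by rw [hs, smul_mul_assoc, mul_smul_comm, hYP, hPY]
        _ = Y * A t := by rw [hPt.2.2, ← mul_assoc, hYP]
  -- Otherwise the traceless part has a zero of finite order `m` at `t₀`, and `B` is its quotient by
  -- `(t - t₀)^m`.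
  · obtain ⟨m, B, hB, hB0, hBF⟩ := (hF hAP).exists_eventuallyEq_pow_smul_nonzero_iff.2 hzero
    refine ⟨B, hB, hB0, ?_, ?_, ?_⟩
    · refine (eventually_eq_of_pow_smul_eq (m := m) (htrace hB) (analyticAt_const (v := 0)) ?_).self_of_nhds
      filter_upwards [hBF, hFtr (fun t => A t * P t)] with t h1 h2
      rw [← Matrix.trace_smul, ← h1, h2, smul_zero]
    · have hT : AnalyticAt ℝ (fun t => (B t).transpose) t₀ :=
        ((LinearMap.toContinuousLinearMap
          (Matrix.transposeLinearEquiv n n ℝ ℝ).toLinearMap).analyticAt _).comp hB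
      have h1 := eventually_eq_of_pow_smul_eq (m := m) hT hB (by
        filter_upwards [hBF, hFP _ hAPP] with t h1 h2
        rw [← Matrix.transpose_smul, ← h1, h2.1])
      have h2 := eventually_eq_of_pow_smul_eq (m := m) (hP.fun_mul hB) hB (by
        filter_upwards [hBF, hFP _ hAPP] with t h1 h2
        rw [← mul_smul_comm, ← h1, h2.2])
      exact h1.and h2
    · filter_upwards [hBF, hPP] with t h1 hPt Y hYP hPY hYB
      have h2 : A t * P t = (t - t₀) ^ m • B t + ((A t * P t).trace / (P t).trace) • P t := by
        rw [← h1]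
        simp [F]
      calc A t * Y = (A t * P t) * Y := by rw [mul_assoc, hPY]
        _ = Y * (A t * P t) := by
          rw [h2, add_mul, mul_add, smul_mul_assoc, smul_mul_assoc, mul_smul_comm, mul_smul_comm,
            hYB, hYP, hPY]
        _ = Y * A t := by rw [hPt.2.2, ← mul_assoc, hYP]

end Projections

/-! ### Gluing continuous eigenframes -/

section Eigenframe

variable {n : Type*} [Fintype n] [DecidableEq n]

/-- The columns of `V t` form an orthonormal basis of eigenvectors of `A t`, with eigenvalues
`ev t`, and they depend continuously on `t ∈ s`. -/
structure IsEigenframe (A V : ℝ → Matrix n n ℝ) (ev : ℝ → n → ℝ) (s : Set ℝ) : Prop where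
  continuousOn : ContinuousOn V s
  transpose_mul : ∀ t ∈ s, (V t).transpose * V t = 1
  mul_eq : ∀ t ∈ s, A t * V t = V t * Matrix.diagonal (ev t)

theorem IsEigenframe.mono {A V : ℝ → Matrix n n ℝ} {ev : ℝ → n → ℝ} {s s' : Set ℝ}
    (h : IsEigenframe A V ev s) (hs : s' ⊆ s) : IsEigenframe A V ev s' :=
  ⟨h.continuousOn.mono hs, fun t ht => h.transpose_mul t (hs ht), fun t ht => h.mul_eq t (hs ht)⟩

/-- Two eigenframes can be glued at a point where eigenvalues only coincide if they coincide on the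
whole right interval. -/
theorem IsEigenframe.glue {A V W : ℝ → Matrix n n ℝ} {ev ev' : ℝ → n → ℝ} {a b c : ℝ}
    (hab : a ≤ b) (hbc : b ≤ c)
    (hV : IsEigenframe A V ev (Icc a b)) (hW : IsEigenframe A W ev' (Icc b c))
    (hgen : ∀ i j, ev' b i = ev' b j → ∀ t ∈ Icc b c, ev' t i = ev' t j) :
    ∃ V' ev'', IsEigenframe A V' ev'' (Icc a c) := by
  have hbl : b ∈ Icc a b := right_mem_Icc.2 hab
  have hbr : b ∈ Icc b c := left_mem_Icc.2 hbc
  set O := (W b).transpose * V b with hO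
  have hWW : W b * (W b).transpose = 1 := mul_eq_one_comm.1 (hW.transpose_mul b hbr)
  -- The constant orthogonal matrix `O` matches the frames at `b`. It mixes only columns with equal
  -- eigenvalues at `b`, hence by `hgen` with equal eigenvalues on all of `Icc b c`, so `W t * O` is
  -- still an eigenframe.
  have hOO : O.transpose * O = 1 := by
    rw [hO, Matrix.transpose_mul, Matrix.transpose_transpose, Matrix.mul_assoc,
      ← Matrix.mul_assoc (W b), hWW, Matrix.one_mul, hV.transpose_mul b hbl]
  have hWO : W b * O = V b := by rw [hO, ← Matrix.mul_assoc, hWW, Matrix.one_mul]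
  have hcomm : Matrix.diagonal (ev' b) * O = O * Matrix.diagonal (ev b) := by
    have h1 : A b * V b = W b * (Matrix.diagonal (ev' b) * O) := by
      rw [← hWO, ← Matrix.mul_assoc, hW.mul_eq b hbr, Matrix.mul_assoc]
    rw [hV.mul_eq b hbl] at h1
    have h2 := congrArg (fun X => (W b).transpose * X) h1
    rw [← Matrix.mul_assoc, ← Matrix.mul_assoc _ (W b), hW.transpose_mul b hbr,
      Matrix.one_mul] at h2
    exact h2.symm
  have hentry : ∀ i j, O i j ≠ 0 → ev' b i = ev b j := by
    intro i j hij
    have := congrFun (congrFun hcomm i) j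
    rw [Matrix.diagonal_mul, Matrix.mul_diagonal, mul_comm] at this
    exact mul_left_cancel₀ hij this
  have hcol : ∀ j, ∃ i, O i j ≠ 0 := by
    intro j
    by_contra! h
    have := congrFun (congrFun hOO j) j
    rw [Matrix.mul_apply] at this
    simp [h] at this
  -- Any row index of a nonzero entry of column `j` will do as `p j`: all of them have the same
  -- eigenvalue.
  choose p hp using hcol
  have hcommt : ∀ t ∈ Icc b c, Matrix.diagonal (ev' t) * O =
      O * Matrix.diagonal (fun j => ev' t (p j)) := by
    intro t ht
    ext i j
    rw [Matrix.diagonal_mul, Matrix.mul_diagonal, mul_comm]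
    by_cases hij : O i j = 0
    · simp [hij]
    · rw [hgen i (p j) ((hentry i j hij).trans (hentry _ j (hp j)).symm) t ht]
  have hleft : ∀ t ∈ Icc a b, (if t ≤ b then V t else W t * O) = V t := fun t ht => if_pos ht.2
  have hright : ∀ t ∈ Icc b c, (if t ≤ b then V t else W t * O) = W t * O := by
    intro t ht
    split_ifs with h
    · rw [le_antisymm h ht.1, hWO]
    · rfl
  refine ⟨fun t => if t ≤ b then V t else W t * O,
    fun t => if t ≤ b then ev t else fun j => ev' t (p j), ?_, ?_, ?_⟩
  · rw [← Icc_union_Icc_eq_Icc hab hbc]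
    refine ContinuousOn.union_of_isClosed (hV.continuousOn.congr hleft)
      ((hW.continuousOn.mul continuousOn_const).congr hright) isClosed_Icc isClosed_Icc
  · intro t ht
    split_ifs with h
    · exact hV.transpose_mul t ⟨ht.1, h⟩
    · rw [Matrix.transpose_mul, Matrix.mul_assoc, ← Matrix.mul_assoc _ (W t),
        hW.transpose_mul t ⟨(not_le.1 h).le, ht.2⟩, Matrix.one_mul, hOO]
  · intro t ht
    split_ifs with h
    · exact hV.mul_eq t ⟨ht.1, h⟩
    · have ht' : t ∈ Icc b c := ⟨(not_le.1 h).le, ht.2⟩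
      rw [← Matrix.mul_assoc, hW.mul_eq t ht', Matrix.mul_assoc, hcommt t ht', ← Matrix.mul_assoc]

/-- A supremum argument: the frame on the left is glued to the local frame around the supremum `c`
at some `b < c`, never at `c` itself, since accidental eigenvalue coincidences of the local frame
are confined to its centre. -/
theorem exists_isEigenframe_of_local {A : ℝ → Matrix n n ℝ} {T : ℝ} (hT : 0 ≤ T)
    (hloc : ∀ t₀ ∈ Icc 0 T, ∃ (V : ℝ → Matrix n n ℝ) (ev : ℝ → n → ℝ) (ε : ℝ), 0 < ε ∧
      IsEigenframe A V ev (Ioo (t₀ - ε) (t₀ + ε) ∩ Icc 0 T) ∧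
      ∀ t ∈ Ioo (t₀ - ε) (t₀ + ε), t ≠ t₀ → ∀ i j, ev t i = ev t j →
        ∀ s ∈ Ioo (t₀ - ε) (t₀ + ε), ev s i = ev s j) :
    ∃ V ev, IsEigenframe A V ev (Icc 0 T) := by
  set S : Set ℝ := {s | s ∈ Icc 0 T ∧ ∃ V ev, IsEigenframe A V ev (Icc 0 s)} with hS
  have hbdd : BddAbove S := ⟨T, fun s hs => hs.1.2⟩
  have h0 : (0 : ℝ) ∈ S := by
    obtain ⟨V, ev, ε, hε, hV, -⟩ := hloc 0 ⟨le_rfl, hT⟩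
    refine ⟨⟨le_rfl, hT⟩, V, ev, hV.mono fun t ht => ?_⟩
    obtain rfl : t = 0 := le_antisymm ht.2 ht.1
    exact ⟨⟨by linarith, by linarith⟩, le_rfl, hT⟩
  set c := sSup S with hc
  have hc0 : 0 ≤ c := le_csSup hbdd h0
  have hcT : c ≤ T := csSup_le ⟨0, h0⟩ fun s hs => hs.1.2
  obtain ⟨V, ev, ε, hε, hV, hgen⟩ := hloc c ⟨hc0, hcT⟩
  have hext : min T (c + ε / 2) ∈ S := by
    have hle : 0 ≤ min T (c + ε / 2) := le_min hT (by linarith)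
    refine ⟨⟨hle, min_le_left _ _⟩, ?_⟩
    rcases hc0.eq_or_lt with hc0 | hc0
    · refine ⟨V, ev, hV.mono fun t ht => ⟨⟨by linarith [ht.1], ?_⟩, ht.1, ht.2.trans (min_le_left _ _)⟩⟩
      linarith [ht.2.trans (min_le_right _ _)]
    · obtain ⟨s, hs, hlt⟩ := exists_lt_of_lt_csSup ⟨0, h0⟩
        (max_lt (show c - ε < sSup S by linarith) (show (0 : ℝ) < sSup S from hc0))
      have hs1 := (le_max_left _ _).trans_lt hlt
      have hs2 := (le_max_right _ _).trans_lt hlt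
      obtain ⟨V₁, ev₁, hV₁⟩ := hs.2
      -- a point strictly between `max (c - ε) 0` and `c`
      set b := (max (c - ε) 0 + s) / 2 with hb
      have hbs : b < s := by linarith
      have hbc : b < c := hbs.trans_le (le_csSup hbdd hs)
      have hb1 : c - ε < b := by linarith [le_max_left (c - ε) 0]
      have hb2 : 0 < b := by linarith [le_max_right (c - ε) 0]
      have hmem : ∀ t ∈ Icc b (min T (c + ε / 2)), t ∈ Ioo (c - ε) (c + ε) := fun t ht =>
        ⟨by linarith [ht.1], by linarith [ht.2.trans (min_le_right _ _)]⟩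
      refine (hV₁.mono (Icc_subset_Icc_right hbs.le)).glue hb2.le
        (le_min (by linarith) (by linarith)) (hV.mono fun t ht => ⟨hmem t ht, by linarith [ht.1],
          ht.2.trans (min_le_left _ _)⟩) (fun i j hij t ht => ?_)
      exact hgen b ⟨hb1, by linarith⟩ hbc.ne i j hij t (hmem t ht)
  have hTc : T ≤ c := by
    by_contra! h
    have h1 := le_csSup hbdd hext
    have h2 : c < min T (c + ε / 2) := lt_min h (by linarith)
    exact absurd h1 (not_le.2 h2)
  have : min T (c + ε / 2) = T := min_eq_left (by linarith)
  rw [this] at hext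
  exact hext.2

end Eigenframe

/-! ### Local and global eigenframes of analytic symmetric matrices -/

section Local

open scoped Matrix.Norms.L2Operator

variable {n : Type*} [Fintype n] [DecidableEq n]

/-- Splitting the identity yields as many nonzero, mutually orthogonal projections as the dimension,
each commuting with `A`. A column that is nonzero at `t₀` is taken from each; normalized, these
columns are orthonormal and diagonalize `A`. -/
theorem exists_local_isEigenframe {A : ℝ → Matrix n n ℝ} {t₀ : ℝ} (hA : AnalyticAt ℝ A t₀)
    (hAs : ∀ᶠ t in 𝓝 t₀, (A t).transpose = A t) :
    ∃ (V : ℝ → Matrix n n ℝ) (ev : ℝ → n → ℝ), (∀ i, AnalyticAt ℝ (fun t => ev t i) t₀) ∧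
      ∀ᶠ t in 𝓝 t₀, ContinuousAt V t ∧ (V t).transpose * V t = 1 ∧
        A t * V t = V t * Matrix.diagonal (ev t) := by
  obtain ⟨ι, _, Q, hcard, hQ, hQ'⟩ := exists_analytic_projections hA hAs (Fintype.card n)
    (fun _ => 1) analyticAt_const (Eventually.of_forall fun t => by simp) (by simp)
  let e : n ≃ ι := Fintype.equivOfCardEq hcard.symm
  have hk : ∀ i, ∃ k, (Q (e i) t₀).col k ≠ 0 := by
    intro i
    by_contra! h
    exact (hQ (e i)).2 (by ext a k; exact congrFun (h k) a)
  choose k hk using hk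
  have hent : ∀ {B : ℝ → Matrix n n ℝ}, AnalyticAt ℝ B t₀ → ∀ a b,
      AnalyticAt ℝ (fun t => B t a b) t₀ := fun hB a b =>
    ((LinearMap.toContinuousLinearMap (Matrix.entryLinearMap ℝ ℝ a b)).analyticAt _).comp hB
  let w : n → ℝ → n → ℝ := fun i t a => Q (e i) t a (k i)
  let q : n → ℝ → ℝ := fun i t => w i t ⬝ᵥ w i t
  have hw : ∀ i a, AnalyticAt ℝ (fun t => w i t a) t₀ := fun i a => hent (hQ (e i)).1 a (k i)
  have hsum : ∀ f : n → ℝ → ℝ, (∀ a, AnalyticAt ℝ (f a) t₀) →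
      AnalyticAt ℝ (fun t => ∑ a, f a t) t₀ := fun f hf =>
    Finset.analyticAt_fun_sum _ fun a _ => hf a
  have hq : ∀ i, AnalyticAt ℝ (q i) t₀ := fun i => hsum _ fun a => (hw i a).fun_mul (hw i a)
  have hq0 : ∀ i, 0 < q i t₀ := fun i => by
    have h1 : 0 ≤ q i t₀ := Finset.sum_nonneg fun a _ => mul_self_nonneg _
    refine h1.lt_of_ne fun h => hk i ?_
    exact dotProduct_self_eq_zero.1 h.symm
  refine ⟨fun t => Matrix.of fun a i => (√(q i t))⁻¹ * w i t a,
    fun t i => (w i t ⬝ᵥ A t *ᵥ w i t) / q i t, fun i => ?_, ?_⟩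
  · refine AnalyticAt.fun_div (hsum _ fun a => (hw i a).fun_mul (hsum _ fun b => ?_)) (hq i) (hq0 i).ne'
    exact (hent hA a b).fun_mul (hw i b)
  have hqpos : ∀ᶠ t in 𝓝 t₀, ∀ i, 0 < q i t :=
    eventually_all.2 fun i => (hq i).continuousAt.eventually_const_lt (hq0 i)
  have hwc : ∀ᶠ t in 𝓝 t₀, ∀ i a, ContinuousAt (fun t => w i t a) t :=
    eventually_all.2 fun i => eventually_all.2 fun a =>
      (hw i a).eventually_analyticAt.mono fun t ht => ht.continuousAt
  filter_upwards [hqpos, hwc, hQ', hAs] with t hqt hct hQt hAt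
  obtain ⟨hQ1, hQ2⟩ := hQt
  have hQw : ∀ i, Q (e i) t *ᵥ w i t = w i t := fun i => by
    funext a
    exact congrFun (congrFun (hQ1 (e i)).1 a) (k i)
  have hQw0 : ∀ i j, i ≠ j → Q (e i) t *ᵥ w j t = 0 := fun i j hij => by
    funext a
    exact congrFun (congrFun (hQ2 (e i) (e j) fun h => hij (e.injective h)) a) (k j)
  have hsymm : ∀ (i : n) (x y : n → ℝ), x ⬝ᵥ Q (e i) t *ᵥ y = Q (e i) t *ᵥ x ⬝ᵥ y := by
    intro i x y
    rw [Matrix.dotProduct_mulVec, ← Matrix.mulVec_transpose, (hQ1 (e i)).2.1]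
  have horth : ∀ i j, i ≠ j → w i t ⬝ᵥ w j t = 0 := by
    intro i j hij
    rw [← hQw j, hsymm, hQw0 j i hij.symm, zero_dotProduct]
  have horthA : ∀ i j, i ≠ j → w i t ⬝ᵥ A t *ᵥ w j t = 0 := by
    intro i j hij
    rw [← hQw j, Matrix.mulVec_mulVec, (hQ1 (e j)).2.2.1, ← Matrix.mulVec_mulVec, hsymm,
      hQw0 j i hij.symm, zero_dotProduct]
  set V : Matrix n n ℝ := Matrix.of fun a i => (√(q i t))⁻¹ * w i t a with hVdef
  have hsq : ∀ i, √(q i t) * √(q i t) = q i t := fun i => Real.mul_self_sqrt (hqt i).le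
  have hsq0 : ∀ i, √(q i t) ≠ 0 := fun i => (Real.sqrt_pos.2 (hqt i)).ne'
  have hVV : V.transpose * V = 1 := by
    ext i j
    have h1 : (V.transpose * V) i j = (√(q i t))⁻¹ * (√(q j t))⁻¹ * (w i t ⬝ᵥ w j t) := by
      simp only [hVdef, Matrix.mul_apply, Matrix.transpose_apply, Matrix.of_apply, dotProduct,
        Finset.mul_sum]
      exact Finset.sum_congr rfl fun a _ => by ring
    rw [h1]
    rcases eq_or_ne i j with rfl | hij
    · rw [Matrix.one_apply_eq, ← mul_inv, hsq]
      exact inv_mul_cancel₀ (hqt i).ne'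
    · rw [horth i j hij, Matrix.one_apply_ne hij, mul_zero]
  refine ⟨?_, hVV, ?_⟩
  · refine continuousAt_pi.2 fun a => continuousAt_pi.2 fun i => ?_
    have h1 : ContinuousAt (q i) t :=
      tendsto_finsetSum _ fun a _ => (hct i a).mul (hct i a)
    exact (h1.sqrt.inv₀ (hsq0 i)).mul (hct i a)
  · have hdiag : V.transpose * (A t * V) =
        Matrix.diagonal fun i => (w i t ⬝ᵥ A t *ᵥ w i t) / q i t := by
      ext i j
      have h1 : (V.transpose * (A t * V)) i j =
          (√(q i t))⁻¹ * (√(q j t))⁻¹ * (w i t ⬝ᵥ A t *ᵥ w j t) := by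
        simp only [hVdef, Matrix.mul_apply, Matrix.transpose_apply, Matrix.of_apply, dotProduct,
          Matrix.mulVec, Finset.mul_sum]
        exact Finset.sum_congr rfl fun a _ => Finset.sum_congr rfl fun b _ => by ring
      rw [h1]
      rcases eq_or_ne i j with rfl | hij
      · rw [Matrix.diagonal_apply_eq, ← mul_inv, hsq, div_eq_inv_mul]
      · rw [horthA i j hij, Matrix.diagonal_apply_ne _ hij, mul_zero]
    rw [← hdiag, ← Matrix.mul_assoc, mul_eq_one_comm.1 hVV, Matrix.one_mul]

/-- A symmetric matrix with analytic entries on a compact interval has a continuous orthonormal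
basis of eigenvectors. -/
theorem exists_isEigenframe {A : ℝ → Matrix n n ℝ} {T : ℝ} (hT : 0 ≤ T)
    (hA : ∀ t₀ ∈ Icc 0 T, ∃ B : ℝ → Matrix n n ℝ, (∀ a b, AnalyticAt ℝ (fun t => B t a b) t₀) ∧
      (∀ t, (B t).transpose = B t) ∧ ∀ᶠ t in 𝓝[Icc 0 T] t₀, A t = B t) :
    ∃ V ev, IsEigenframe A V ev (Icc 0 T) := by
  refine exists_isEigenframe_of_local hT fun t₀ ht₀ => ?_
  obtain ⟨B, hB, hBs, hAB⟩ := hA t₀ ht₀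
  have hB' : AnalyticAt ℝ B t₀ := by
    have h1 : B = fun t => ∑ a, ∑ b, B t a b • Matrix.single a b (1 : ℝ) := by
      funext t
      conv_lhs => rw [Matrix.matrix_eq_sum_single (B t)]
      simp [Matrix.smul_single]
    rw [h1]
    exact Finset.analyticAt_fun_sum _ fun a _ => Finset.analyticAt_fun_sum _ fun b _ =>
      (hB a b).fun_smul analyticAt_const
  obtain ⟨V, ev, hev, hV⟩ := exists_local_isEigenframe hB' (Eventually.of_forall hBs)
  have hdich : ∀ i j, (∀ᶠ t in 𝓝 t₀, ev t i = ev t j) ∨ ∀ᶠ t in 𝓝[≠] t₀, ev t i ≠ ev t j :=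
    fun i j => (hev i).eventually_eq_or_eventually_ne (hev j)
  -- Two analytic eigenvalues either coincide near `t₀` or differ on a punctured neighbourhood.
  have hgen : ∀ᶠ t in 𝓝 t₀, ∀ i j, (∀ᶠ t in 𝓝 t₀, ev t i = ev t j) ∧ ev t i = ev t j ∨
      (¬ ∀ᶠ t in 𝓝 t₀, ev t i = ev t j) ∧ (t ≠ t₀ → ev t i ≠ ev t j) := by
    refine eventually_all.2 fun i => eventually_all.2 fun j => ?_
    by_cases h : ∀ᶠ t in 𝓝 t₀, ev t i = ev t j
    · exact h.mono fun t ht => Or.inl ⟨h, ht⟩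
    · have h' := (hdich i j).resolve_left h
      rw [eventually_nhdsWithin_iff] at h'
      exact h'.mono fun t ht => Or.inr ⟨h, ht⟩
  rw [eventually_nhdsWithin_iff] at hAB
  obtain ⟨ε, hε, hall⟩ := Metric.eventually_nhds_iff_ball.1 (hV.and (hgen.and hAB))
  rw [Real.ball_eq_Ioo] at hall
  refine ⟨V, ev, ε, hε, ⟨fun t ht => ((hall t ht.1).1.1).continuousWithinAt,
    fun t ht => (hall t ht.1).1.2.1, fun t ht => ?_⟩, ?_⟩
  · rw [(hall t ht.1).2.2 ht.2, (hall t ht.1).1.2.2]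
  · intro t ht hne i j hij s hs
    rcases (hall t ht).2.1 i j with ⟨h, -⟩ | h
    · rcases (hall s hs).2.1 i j with h' | h'
      · exact h'.2
      · exact absurd h h'.1
    · exact absurd hij (h.2 hne)

end Local

/-! ### The gradients of the squared TD error -/

section Gradient

variable {S A : Type*} {n d₀ : ℕ} (x : S → A → Fin d₀ → ℝ) (data : Fin n → S × A) (y : S → A → ℝ)

/-- The gradient of the squared TD error. -/
def tdGrad (E : Matrix (Fin 1) (Fin d₀) ℝ) : Matrix (Fin 1) (Fin d₀) ℝ :=
  Matrix.of fun _ b => ∑ i, 2 * ((E *ᵥ x (data i).1 (data i).2) 0 - y (data i).1 (data i).2) *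
    x (data i).1 (data i).2 b

theorem hasDerivAt_tdLoss (E K : Matrix (Fin 1) (Fin d₀) ℝ) :
    HasDerivAt (fun h : ℝ => tdLoss x data y (E + h • K)) (frob (tdGrad x data y E) K) 0 := by
  have h1 : ∀ i ∈ (Finset.univ : Finset (Fin n)), HasDerivAt
      (fun h : ℝ => (((E + h • K) *ᵥ x (data i).1 (data i).2) 0 - y (data i).1 (data i).2) ^ 2)
      (2 * ((E *ᵥ x (data i).1 (data i).2) 0 - y (data i).1 (data i).2) *
        (K *ᵥ x (data i).1 (data i).2) 0) 0 := by
    intro i _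
    have h2 : HasDerivAt (fun h : ℝ => (E *ᵥ x (data i).1 (data i).2) 0 +
        h * (K *ᵥ x (data i).1 (data i).2) 0 - y (data i).1 (data i).2)
        ((K *ᵥ x (data i).1 (data i).2) 0) 0 := by
      simpa using (((hasDerivAt_id (0 : ℝ)).mul_const ((K *ᵥ x (data i).1 (data i).2) 0)).const_add
        ((E *ᵥ x (data i).1 (data i).2) 0)).sub_const (y (data i).1 (data i).2)
    simpa [Matrix.add_mulVec, Matrix.smul_mulVec] using h2.fun_pow 2
  refine (HasDerivAt.fun_sum h1).congr_deriv ?_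
  simp only [frob, tdGrad, Matrix.of_apply, Finset.univ_unique, Fin.default_eq_zero, Fin.isValue,
    Finset.sum_singleton, Finset.sum_mul, Matrix.mulVec, dotProduct, Finset.mul_sum]
  rw [Finset.sum_comm]
  exact Finset.sum_congr rfl fun b _ => Finset.sum_congr rfl fun i _ => by ring

theorem frob_mul_single_mul {p q : Type*} [Fintype p] [Fintype q] [DecidableEq p] [DecidableEq q]
    (g : Matrix (Fin 1) (Fin d₀) ℝ) (C : Matrix (Fin 1) p ℝ) (D : Matrix q (Fin d₀) ℝ) (a : p) (b : q) :
    frob g (C * Matrix.single a b (1 : ℝ) * D) = (Cᵀ * g * Dᵀ) a b := by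
  have h : ∀ i j, (C * Matrix.single a b (1 : ℝ) * D) i j = C i a * D b j := by
    intro i j
    rw [Matrix.mul_apply, Finset.sum_eq_single b]
    · simp
    · intro k _ hk
      rw [Matrix.mul_single_apply_of_ne _ _ _ _ _ hk, zero_mul]
    · simp
  simp only [frob, h, Matrix.mul_apply, Matrix.transpose_apply, Finset.sum_mul]
  rw [Finset.sum_comm]
  exact Finset.sum_congr rfl fun _ _ => Finset.sum_congr rfl fun _ _ => by ring

/-- The chain rule for `X ↦ C X D`. The gradients in a hidden layer, in the last layer and in the
end-to-end matrix are all special cases. -/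
theorem matGrad_tdLoss_comp {p q : Type*} [Fintype p] [Fintype q] [DecidableEq p] [DecidableEq q]
    (C : Matrix (Fin 1) p ℝ) (D : Matrix q (Fin d₀) ℝ) (X : Matrix p q ℝ) :
    matGrad (fun X => tdLoss x data y (C * X * D)) X = Cᵀ * tdGrad x data y (C * X * D) * Dᵀ := by
  ext a b
  rw [matGrad, Matrix.of_apply, ← frob_mul_single_mul]
  refine HasDerivAt.deriv ?_
  convert! hasDerivAt_tdLoss x data y (C * X * D) (C * Matrix.single a b (1 : ℝ) * D) using 3 with h
  rw [Matrix.mul_add, Matrix.add_mul, Matrix.mul_smul, Matrix.smul_mul]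

theorem matGrad_tdLoss (E : Matrix (Fin 1) (Fin d₀) ℝ) :
    matGrad (tdLoss x data y) E = tdGrad x data y E := by
  have := matGrad_tdLoss_comp x data y 1 1 E
  simpa using this

end Gradient

/-! ### Partial products of the layers -/

section Layers

variable {d : ℕ → ℕ} (W : (j : ℕ) → Matrix (Fin (d (j + 1))) (Fin (d j)) ℝ)

/-- The product `W_{m-1} ⋯ W_j` (layers indexed from zero), for `j ≤ m`. -/
def upperProd (j : ℕ) : (m : ℕ) → Matrix (Fin (d m)) (Fin (d j)) ℝ
  -- The rectangular identity avoids a cast between widths; it is the true identity for `j = m` and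
  -- a default value for `j > m`.
  | 0 => Matrix.of fun a b => if (a : ℕ) = b then 1 else 0
  | m + 1 => if j ≤ m then W m * upperProd j m else
      Matrix.of fun a b => if (a : ℕ) = b then 1 else 0

theorem upperProd_self (m : ℕ) : upperProd W m m = 1 := by
  have h : (Matrix.of fun (a b : Fin (d m)) => if (a : ℕ) = b then (1 : ℝ) else 0) = 1 := by
    ext a b
    simp [Matrix.one_apply, Fin.ext_iff]
  cases m with
  | zero => exact h
  | succ m => rw [upperProd, if_neg (by omega)]; exact h

theorem upperProd_succ {j m : ℕ} (h : j ≤ m) : upperProd W j (m + 1) = W m * upperProd W j m := by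
  rw [upperProd, if_pos h]

theorem upperProd_succ_mul {j m : ℕ} (h : j < m) :
    upperProd W (j + 1) m * W j = upperProd W j m := by
  induction m, h using Nat.le_induction with
  | base => rw [upperProd_self, upperProd_succ W le_rfl, upperProd_self, Matrix.one_mul, Matrix.mul_one]
  | succ m hm ih => rw [upperProd_succ W hm, Matrix.mul_assoc, ih, upperProd_succ W (by omega)]

theorem upperProd_mul_layerProd {j m : ℕ} (h : j ≤ m) :
    upperProd W j m * layerProd W j = layerProd W m := by
  induction m, h using Nat.le_induction with
  | base => rw [upperProd_self, Matrix.one_mul]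
  | succ m hm ih => rw [upperProd_succ W hm, Matrix.mul_assoc, ih, layerProd]

theorem layerProd_update_of_le {j n : ℕ} (h : n ≤ j) (Y : Matrix (Fin (d (j + 1))) (Fin (d j)) ℝ) :
    layerProd (Function.update W j Y) n = layerProd W n := by
  induction n with
  | zero => rfl
  | succ n ih => rw [layerProd, layerProd, ih (by omega), Function.update_of_ne (by omega)]

theorem layerProd_update {j m : ℕ} (h : j < m) (Y : Matrix (Fin (d (j + 1))) (Fin (d j)) ℝ) :
    layerProd (Function.update W j Y) m = upperProd W (j + 1) m * Y * layerProd W j := by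
  induction m, h using Nat.le_induction with
  | base => rw [layerProd, Function.update_self, layerProd_update_of_le W le_rfl, upperProd_self,
      Matrix.one_mul]
  | succ m hm ih =>
    rw [layerProd, ih, Function.update_of_ne (by omega), upperProd_succ W hm]
    simp only [Matrix.mul_assoc]

/-- The first `m` layers are balanced. -/
def BalancedLayers (m : ℕ) : Prop := ∀ j, j + 1 < m → (W (j + 1))ᵀ * W (j + 1) = W j * (W j)ᵀ

variable {W} {m : ℕ}

/-- Balancedness turns `W_jᵀ W_j` into `W_{j-1} W_{j-1}ᵀ`, which slides past one factor of the
product at a time, down to the first layer. -/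
theorem BalancedLayers.transpose_mul_self_mul_layerProd (hW : BalancedLayers W m) {j : ℕ}
    (hj : j < m) : ((W j)ᵀ * W j) * layerProd W j = layerProd W j * ((W 0)ᵀ * W 0) := by
  induction j with
  | zero => simp [layerProd]
  | succ j ih =>
    rw [hW j hj, layerProd, Matrix.mul_assoc, ← Matrix.mul_assoc _ (W j), ih (by omega),
      Matrix.mul_assoc]

/-- The Gram matrix of the product of the first `j` layers is a power of that of the first. -/
theorem BalancedLayers.transpose_layerProd_mul_layerProd (hW : BalancedLayers W m) {j : ℕ}
    (hj : j ≤ m) : (layerProd W j)ᵀ * layerProd W j = ((W 0)ᵀ * W 0) ^ j := by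
  induction j with
  | zero => simp [layerProd]
  | succ j ih =>
    rw [layerProd, Matrix.transpose_mul, Matrix.mul_assoc, ← Matrix.mul_assoc _ (W j),
      hW.transpose_mul_self_mul_layerProd hj, ← Matrix.mul_assoc, ih (by omega), pow_succ]

/-- The mirror image: the Gram matrix slides upwards to the last layer. -/
theorem BalancedLayers.upperProd_mul_mul_transpose (hW : BalancedLayers W (m + 1)) {j : ℕ}
    (hj : j ≤ m) :
    upperProd W (j + 1) (m + 1) * (W j * (W j)ᵀ) = (W m * (W m)ᵀ) * upperProd W (j + 1) (m + 1) := by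
  induction hj using Nat.decreasingInduction with
  | self => rw [upperProd_self, Matrix.mul_one, Matrix.one_mul]
  | of_succ j hj ih =>
    rw [← hW j (by omega), ← upperProd_succ_mul W (j := j + 1) (by omega), Matrix.mul_assoc,
      ← Matrix.mul_assoc (W (j + 1)), ← Matrix.mul_assoc, ih, Matrix.mul_assoc]

theorem BalancedLayers.upperProd_mul_transpose (hW : BalancedLayers W (m + 1)) {j : ℕ}
    (hj : j ≤ m + 1) :
    upperProd W j (m + 1) * (upperProd W j (m + 1))ᵀ = (W m * (W m)ᵀ) ^ (m + 1 - j) := by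
  induction hj using Nat.decreasingInduction with
  | self => simp [upperProd_self]
  | of_succ j hj ih =>
    rw [← upperProd_succ_mul W hj, Matrix.transpose_mul, Matrix.mul_assoc, ← Matrix.mul_assoc (W j),
      ← Matrix.mul_assoc, hW.upperProd_mul_mul_transpose (by omega), Matrix.mul_assoc, ih,
      ← pow_succ']
    congr 1
    omega

end Layers

/-! ### Eigenvectors of powers -/

section Root

variable {n : Type*} [Fintype n] [DecidableEq n]

theorem pow_mulVec_of_mulVec_eq_smul {B : Matrix n n ℝ} {v : n → ℝ} {μ : ℝ} (h : B *ᵥ v = μ • v)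
    (i : ℕ) : B ^ i *ᵥ v = μ ^ i • v := by
  induction i with
  | zero => simp
  | succ i ih =>
    rw [pow_succ, ← Matrix.mulVec_mulVec, h, Matrix.mulVec_smul, ih, smul_smul, pow_succ, mul_comm]

/-- An eigenvector of a power of a positive semidefinite matrix is an eigenvector of the matrix. -/
theorem mulVec_eq_smul_of_pow_mulVec {B : Matrix n n ℝ} (hB : B.PosSemidef) {v : n → ℝ} {μ : ℝ}
    (hμ : 0 ≤ μ) {m : ℕ} (hm : m ≠ 0) (h : B ^ m *ᵥ v = μ ^ m • v) : B *ᵥ v = μ • v := by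
  set b := hB.isHermitian.eigenvalues
  set w : n → n → ℝ := fun j => ⇑(hB.isHermitian.eigenvectorBasis j) with hw
  have hBt : Bᵀ = B := by
    have := hB.isHermitian
    rwa [Matrix.IsHermitian, Matrix.conjTranspose_eq_transpose_of_trivial] at this
  have hbw : ∀ j, B *ᵥ w j = b j • w j := hB.isHermitian.mulVec_eigenvectorBasis
  have hsymm : ∀ i j z, w j ⬝ᵥ (B ^ i *ᵥ z) = b j ^ i * (w j ⬝ᵥ z) := by
    intro i j z
    rw [Matrix.dotProduct_mulVec, ← Matrix.mulVec_transpose, Matrix.transpose_pow, hBt,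
      pow_mulVec_of_mulVec_eq_smul (hbw j), smul_dotProduct, smul_eq_mul]
  -- In an eigenbasis, each nonzero coordinate of `v` forces `b j ^ m = μ ^ m`, hence `b j = μ`
  -- since both are nonnegative.
  have key : ∀ j, w j ⬝ᵥ (B *ᵥ v - μ • v) = 0 := by
    intro j
    have h1 := hsymm m j v
    rw [h, dotProduct_smul, smul_eq_mul] at h1
    have h2 := hsymm 1 j v
    rw [pow_one, pow_one] at h2
    rw [dotProduct_sub, h2, dotProduct_smul, smul_eq_mul, ← sub_mul]
    by_cases hz : w j ⬝ᵥ v = 0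
    · rw [hz, mul_zero]
    · have h3 := mul_right_cancel₀ hz h1
      rw [(pow_left_inj₀ hμ (hB.eigenvalues_nonneg j) hm).1 h3, sub_self, zero_mul]
  have hzero : WithLp.toLp 2 (B *ᵥ v - μ • v) = 0 := by
    refine InnerProductSpace.ext_inner_left_basis (𝕜 := ℝ)
      hB.isHermitian.eigenvectorBasis.toBasis fun j => ?_
    rw [inner_zero_right, OrthonormalBasis.coe_toBasis, EuclideanSpace.inner_eq_star_dotProduct]
    simpa [dotProduct_comm] using key j
  exact sub_eq_zero.1 ((WithLp.toLp_eq_zero 2).1 hzero)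

end Root

/-! ### Derivatives of matrices and of singular values -/

section MatDeriv

variable {m n p : Type*}

/-- Entrywise derivative of a matrix-valued function within a set. -/
def HasMatDerivWithinAt (X : ℝ → Matrix m n ℝ) (X' : Matrix m n ℝ) (s : Set ℝ) (t : ℝ) : Prop :=
  ∀ a b, HasDerivWithinAt (fun τ => X τ a b) (X' a b) s t

variable {X : ℝ → Matrix m n ℝ} {X' : Matrix m n ℝ} {s : Set ℝ} {t : ℝ}

theorem HasMatDerivWithinAt.transpose (h : HasMatDerivWithinAt X X' s t) :
    HasMatDerivWithinAt (fun τ => (X τ)ᵀ) X'ᵀ s t := fun a b => h b a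

theorem HasMatDerivWithinAt.mul [Fintype n] {Y : ℝ → Matrix n p ℝ} {Y' : Matrix n p ℝ}
    (hX : HasMatDerivWithinAt X X' s t) (hY : HasMatDerivWithinAt Y Y' s t) :
    HasMatDerivWithinAt (fun τ => X τ * Y τ) (X' * Y t + X t * Y') s t := by
  intro a b
  simp only [Matrix.mul_apply, Matrix.add_apply, ← Finset.sum_add_distrib]
  exact HasDerivWithinAt.fun_sum fun i _ => (hX a i).mul (hY i b)

theorem HasMatDerivWithinAt.tendsto_slope (h : HasMatDerivWithinAt X X' s t) :
    Tendsto (fun τ => (τ - t)⁻¹ • (X τ - X t)) (𝓝[s \ {t}] t) (𝓝 X') := by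
  refine tendsto_pi_nhds.2 fun a => tendsto_pi_nhds.2 fun b => ?_
  exact hasDerivWithinAt_iff_tendsto_slope.1 (h a b)

/-- The derivative of a singular value with continuous singular vectors. -/
theorem hasDerivWithinAt_singularValue [Fintype m] [Fintype n] {σ : ℝ → ℝ} {u : ℝ → m → ℝ} {v : ℝ → n → ℝ}
    (hX : HasMatDerivWithinAt X X' s t) (hu : ContinuousOn u s) (hv : ContinuousOn v s)
    (h : ∀ τ ∈ s, IsSingularTriple (X τ) (σ τ) (u τ) (v τ)) (ht : t ∈ s) :
    HasDerivWithinAt σ (u t ⬝ᵥ X' *ᵥ v t) s t := by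
  -- With `Δ = X τ - X t`, the singular vector equations give exactly `u t ⬝ Δ (v τ) + u τ ⬝ Δ (v t)
  -- = (σ τ - σ t) (u t ⬝ u τ + v t ⬝ v τ)`, where the last factor tends to `2`. So no derivative of
  -- `u` or `v` is needed.
  rw [hasDerivWithinAt_iff_tendsto_slope]
  have hut : Tendsto u (𝓝[s \ {t}] t) (𝓝 (u t)) :=
    (hu t ht).mono_left (nhdsWithin_mono _ sdiff_subset)
  have hvt : Tendsto v (𝓝[s \ {t}] t) (𝓝 (v t)) :=
    (hv t ht).mono_left (nhdsWithin_mono _ sdiff_subset)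
  have hcont : Continuous fun q : (m → ℝ) × Matrix m n ℝ × (n → ℝ) => q.1 ⬝ᵥ q.2.1 *ᵥ q.2.2 := by
    fun_prop
  have hbil : ∀ {f : ℝ → m → ℝ} {g : ℝ → n → ℝ}, Tendsto f (𝓝[s \ {t}] t) (𝓝 (u t)) →
      Tendsto g (𝓝[s \ {t}] t) (𝓝 (v t)) →
      Tendsto (fun τ => f τ ⬝ᵥ ((τ - t)⁻¹ • (X τ - X t)) *ᵥ g τ) (𝓝[s \ {t}] t)
        (𝓝 (u t ⬝ᵥ X' *ᵥ v t)) := fun hf hg =>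
    (hcont.tendsto (u t, X', v t)).comp (hf.prodMk_nhds (hX.tendsto_slope.prodMk_nhds hg))
  have hden : Tendsto (fun τ => u t ⬝ᵥ u τ + v t ⬝ᵥ v τ) (𝓝[s \ {t}] t) (𝓝 2) := by
    have h1 : Tendsto (fun τ => u t ⬝ᵥ u τ) (𝓝[s \ {t}] t) (𝓝 (u t ⬝ᵥ u t)) :=
      ((show Continuous fun q : m → ℝ => u t ⬝ᵥ q by fun_prop).tendsto (u t)).comp hut
    have h2 : Tendsto (fun τ => v t ⬝ᵥ v τ) (𝓝[s \ {t}] t) (𝓝 (v t ⬝ᵥ v t)) :=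
      ((show Continuous fun q : n → ℝ => v t ⬝ᵥ q by fun_prop).tendsto (v t)).comp hvt
    have h3 := h1.add h2
    rw [(h t ht).left_unit, (h t ht).right_unit] at h3
    norm_num at h3
    exact h3
  have hlim := ((hbil tendsto_const_nhds hvt).add (hbil hut tendsto_const_nhds)).div hden two_ne_zero
  rw [add_self_div_two] at hlim
  refine hlim.congr' ?_
  filter_upwards [hden.eventually_ne two_ne_zero, self_mem_nhdsWithin] with τ hne hτ
  have hτs := h τ hτ.1
  have hts := h t ht
  have hl : ∀ a : ℝ, IsSingularTriple (X a) (σ a) (u a) (v a) → ∀ z : n → ℝ,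
      u a ⬝ᵥ X a *ᵥ z = σ a * (v a ⬝ᵥ z) := by
    intro a ha z
    rw [Matrix.dotProduct_mulVec, ← Matrix.mulVec_transpose, ha.mulVec_left, smul_dotProduct,
      smul_eq_mul]
  have hr : ∀ a : ℝ, IsSingularTriple (X a) (σ a) (u a) (v a) → ∀ z : m → ℝ,
      z ⬝ᵥ X a *ᵥ v a = σ a * (z ⬝ᵥ u a) := by
    intro a ha z
    rw [ha.mulVec_right, dotProduct_smul, smul_eq_mul]
  rw [slope_def_field, Pi.div_apply, div_eq_iff hne]
  simp only [Matrix.smul_mulVec, Matrix.sub_mulVec, dotProduct_smul, dotProduct_sub,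
    smul_eq_mul]
  rw [hl t hts, hl τ hτs, hr t hts, hr τ hτs, dotProduct_comm (u τ) (u t),
    dotProduct_comm (v τ) (v t)]
  ring

theorem frob_vecMulVec [Fintype m] [Fintype n] (M : Matrix m n ℝ) (u : m → ℝ) (v : n → ℝ) :
    frob M (Matrix.vecMulVec u v) = u ⬝ᵥ M *ᵥ v := by
  simp only [frob, Matrix.vecMulVec_apply, dotProduct, Matrix.mulVec, Finset.mul_sum]
  exact Finset.sum_congr rfl fun _ _ => Finset.sum_congr rfl fun _ _ => by ring

theorem real_dotProduct_self_nonneg [Fintype m] (u : m → ℝ) : 0 ≤ u ⬝ᵥ u :=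
  Finset.sum_nonneg fun _ _ => mul_self_nonneg _

theorem abs_dotProduct_le_sqrt [Fintype m] (u v : m → ℝ) : |u ⬝ᵥ v| ≤ √(u ⬝ᵥ u) * √(v ⬝ᵥ v) := by
  rw [← Real.sqrt_mul (real_dotProduct_self_nonneg u)]
  refine Real.abs_le_sqrt ?_
  simpa [dotProduct, pow_two] using Finset.sum_mul_sq_le_sq_mul_sq Finset.univ u v

/-- An eigenvalue of `Zᵀ Z` that vanishes at one point vanishes identically, if the velocity of `Z`
factors through a matrix `Y` with `Yᵀ Y = Z Zᵀ`. -/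
theorem eigenvalue_eq_zero_of_eq_zero [Fintype m] [Fintype n] [Fintype p]
    {Z : ℝ → Matrix m n ℝ} {Y : ℝ → Matrix p m ℝ}
    {R : ℝ → Matrix p n ℝ} {T t₀ : ℝ} {μ : ℝ → ℝ} {v : ℝ → n → ℝ}
    (hZ : ∀ t ∈ Icc 0 T, HasMatDerivWithinAt Z ((Y t)ᵀ * R t) (Icc 0 T) t)
    (hYZ : ∀ t ∈ Icc 0 T, (Y t)ᵀ * Y t = Z t * (Z t)ᵀ)
    (hR : ContinuousOn R (Icc 0 T)) (hv : ContinuousOn v (Icc 0 T))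
    (hv1 : ∀ t ∈ Icc 0 T, v t ⬝ᵥ v t = 1)
    (hμ : ∀ t ∈ Icc 0 T, ((Z t)ᵀ * Z t) *ᵥ v t = μ t • v t)
    (ht₀ : t₀ ∈ Icc 0 T) (h0 : μ t₀ = 0) : ∀ t ∈ Icc 0 T, μ t = 0 := by
  have hμZ : ∀ t ∈ Icc 0 T, μ t = (Z t *ᵥ v t) ⬝ᵥ (Z t *ᵥ v t) := by
    intro t ht
    have h1 := congrArg (fun w => v t ⬝ᵥ w) (hμ t ht)
    simp only [dotProduct_smul, hv1 t ht, smul_eq_mul, mul_one] at h1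
    rw [← h1, ← Matrix.mulVec_mulVec, Matrix.dotProduct_mulVec, Matrix.vecMul_transpose]
  have hμ0 : ∀ t ∈ Icc 0 T, 0 ≤ μ t := fun t ht => by
    rw [hμZ t ht]
    exact real_dotProduct_self_nonneg _
  have htriple : ∀ t ∈ Icc 0 T, IsSingularTriple ((Z t)ᵀ * Z t) (μ t) (v t) (v t) := fun t ht =>
    ⟨hμ0 t ht, hv1 t ht, hv1 t ht, hμ t ht, by
      rw [Matrix.transpose_mul, Matrix.transpose_transpose, hμ t ht]⟩
  have hder : ∀ t ∈ Icc 0 T, HasDerivWithinAt μ (2 * ((Y t *ᵥ (Z t *ᵥ v t)) ⬝ᵥ (R t *ᵥ v t)))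
      (Icc 0 T) t := by
    intro t ht
    refine (hasDerivWithinAt_singularValue ((hZ t ht).transpose.mul (hZ t ht)) hv hv htriple
      ht).congr_deriv ?_
    have h1 : v t ⬝ᵥ ((Z t)ᵀ * ((Y t)ᵀ * R t)) *ᵥ v t =
        (Y t *ᵥ (Z t *ᵥ v t)) ⬝ᵥ (R t *ᵥ v t) := by
      rw [← Matrix.mulVec_mulVec, ← Matrix.mulVec_mulVec, Matrix.dotProduct_mulVec,
        Matrix.vecMul_transpose, Matrix.dotProduct_mulVec, Matrix.vecMul_transpose]
    have h2 : v t ⬝ᵥ (((Y t)ᵀ * R t)ᵀ * Z t) *ᵥ v t =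
        (Y t *ᵥ (Z t *ᵥ v t)) ⬝ᵥ (R t *ᵥ v t) := by
      rw [Matrix.transpose_mul, Matrix.transpose_transpose, Matrix.mul_assoc,
        ← Matrix.mulVec_mulVec, ← Matrix.mulVec_mulVec, Matrix.dotProduct_mulVec,
        Matrix.vecMul_transpose, dotProduct_comm]
    rw [Matrix.add_mulVec, dotProduct_add, h1, h2, two_mul]
  have hRv : ContinuousOn (fun t => √((R t *ᵥ v t) ⬝ᵥ (R t *ᵥ v t))) (Icc 0 T) := by
    have hmul : ContinuousOn (fun t => R t *ᵥ v t) (Icc 0 T) :=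
      continuousOn_pi.2 fun a => continuousOn_finsetSum _ fun b _ =>
        (continuousOn_pi.1 (continuousOn_pi.1 hR a) b).mul (continuousOn_pi.1 hv b)
    exact (continuousOn_finsetSum _ fun a _ =>
      (continuousOn_pi.1 hmul a).mul (continuousOn_pi.1 hmul a)).sqrt
  obtain ⟨C, hC⟩ := isCompact_Icc.exists_bound_of_continuousOn hRv
  refine eqOn_zero_of_norm_deriv_le (K := 2 * C) hder (fun t ht => ?_) ht₀ h0
  -- The crucial gain: `‖Z v‖` is only `√μ`, but `‖Y Z v‖ = ‖Zᵀ Z v‖ = μ`, so the derivative of `μ`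
  -- is at most a constant times `μ`.
  have hYZv : (Y t *ᵥ (Z t *ᵥ v t)) ⬝ᵥ (Y t *ᵥ (Z t *ᵥ v t)) = μ t ^ 2 := by
    calc _ = (Z t *ᵥ v t) ⬝ᵥ (((Y t)ᵀ * Y t) *ᵥ (Z t *ᵥ v t)) := by
          rw [← Matrix.mulVec_mulVec, Matrix.dotProduct_mulVec _ (Y t)ᵀ, Matrix.vecMul_transpose]
      _ = (((Z t)ᵀ * Z t) *ᵥ v t) ⬝ᵥ (((Z t)ᵀ * Z t) *ᵥ v t) := by
          rw [hYZ t ht, ← Matrix.mulVec_mulVec, Matrix.dotProduct_mulVec, ← Matrix.mulVec_transpose]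
          simp only [Matrix.mulVec_mulVec]
      _ = μ t ^ 2 := by
          rw [hμ t ht, smul_dotProduct, dotProduct_smul, hv1 t ht]
          simp [pow_two]
  have hle := abs_dotProduct_le_sqrt (Y t *ᵥ (Z t *ᵥ v t)) (R t *ᵥ v t)
  rw [hYZv, Real.sqrt_sq (hμ0 t ht)] at hle
  have hC' := (le_abs_self _).trans (hC t ht)
  rw [Real.norm_eq_abs, Real.norm_eq_abs, abs_mul, abs_two, abs_of_nonneg (hμ0 t ht)]
  nlinarith [hμ0 t ht]

end MatDeriv

/-! ### Gradient flow on the layers -/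

section Flow

variable {d : ℕ → ℕ} {m : ℕ} {η T : ℝ}
  {W : ℝ → (j : ℕ) → Matrix (Fin (d (j + 1))) (Fin (d j)) ℝ}
  {M : ℝ → Matrix (Fin (d m)) (Fin (d 0)) ℝ}

/-- The first `m` layers follow the gradient flow of a function whose gradient with respect to the
product of these layers is `M`. -/
def IsLayerFlow (m : ℕ) (η T : ℝ) (W : ℝ → (j : ℕ) → Matrix (Fin (d (j + 1))) (Fin (d j)) ℝ)
    (M : ℝ → Matrix (Fin (d m)) (Fin (d 0)) ℝ) : Prop :=
  ∀ t ∈ Icc 0 T, ∀ j < m, HasMatDerivWithinAt (fun τ => W τ j)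
    (-η • ((upperProd (W t) (j + 1) m)ᵀ * M t * (layerProd (W t) j)ᵀ)) (Icc 0 T) t

/-- Gradient flow preserves balancedness. -/
theorem IsLayerFlow.balanced (h : IsLayerFlow m η T W M) (h0 : BalancedLayers (W 0) m) :
    ∀ t ∈ Icc 0 T, BalancedLayers (W t) m := by
  intro t ht j hj
  have hT : (0 : ℝ) ∈ Icc 0 T := ⟨le_rfl, ht.1.trans ht.2⟩
  ext a b
  have key : ∀ t ∈ Icc 0 T, ((W t (j + 1))ᵀ * W t (j + 1)) a b - (W t j * (W t j)ᵀ) a b = 0 := by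
    refine eqOn_zero_of_norm_deriv_le (K := 0) (f' := fun _ => 0) (fun t ht => ?_)
      (fun t ht => by simp) hT (by rw [h0 j hj, sub_self])
    have h1 := h t ht (j + 1) hj
    have h2 := h t ht j (by omega)
    refine ((h1.transpose.mul h1 a b).sub (h2.mul h2.transpose a b)).congr_deriv ?_
    -- Both sides are the gradient in the product of the two adjacent layers, multiplied by these
    -- layers; hence the two Gram matrices have the same velocity.
    have hG : (W t (j + 1))ᵀ * ((upperProd (W t) (j + 2) m)ᵀ * M t * (layerProd (W t) (j + 1))ᵀ) =
        (upperProd (W t) (j + 1) m)ᵀ * M t * (layerProd (W t) j)ᵀ * (W t j)ᵀ := by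
      rw [← upperProd_succ_mul (W t) hj, layerProd, Matrix.transpose_mul, Matrix.transpose_mul]
      simp only [Matrix.mul_assoc]
    have hG' := congrArg Matrix.transpose hG
    rw [Matrix.transpose_mul, Matrix.transpose_transpose, Matrix.transpose_mul _ (W t j)ᵀ,
      Matrix.transpose_transpose] at hG'
    rw [Matrix.transpose_smul, Matrix.transpose_smul, Matrix.smul_mul, Matrix.mul_smul,
      Matrix.smul_mul, Matrix.mul_smul, hG, hG', add_comm, sub_self]
  exact sub_eq_zero.1 (key t ht)

theorem IsLayerFlow.hasMatDerivWithinAt_layerProd (h : IsLayerFlow m η T W M) {t : ℝ}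
    (ht : t ∈ Icc 0 T) {n : ℕ} (hn : n ≤ m) :
    HasMatDerivWithinAt (fun τ => layerProd (W τ) n)
      (∑ j ∈ Finset.range n, upperProd (W t) (j + 1) n *
        (-η • ((upperProd (W t) (j + 1) m)ᵀ * M t * (layerProd (W t) j)ᵀ)) * layerProd (W t) j)
      (Icc 0 T) t := by
  induction n with
  | zero => exact fun a b => by simpa [layerProd] using hasDerivWithinAt_const _ _ _
  | succ n ih =>
    have h1 := (h t ht n (by omega)).mul (ih (by omega))
    rw [Finset.sum_range_succ, upperProd_self, Matrix.one_mul]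
    refine fun a b => (h1 a b).congr_deriv ?_
    rw [add_comm (-η • _ * _), Matrix.mul_sum]
    refine congrFun (congrFun (congrArg (· + _) (Finset.sum_congr rfl fun j hj => ?_)) a) b
    rw [upperProd_succ (W t) (Finset.mem_range.1 hj)]
    simp only [Matrix.mul_assoc]

/-- The velocity of the product of balanced layers, tested against singular vectors. -/
theorem IsLayerFlow.dotProduct_velocity (hm : m ≠ 0) {t : ℝ} (hW : BalancedLayers (W t) m)
    {σ : ℝ} {u : Fin (d m) → ℝ} {v : Fin (d 0) → ℝ}
    (h : IsSingularTriple (layerProd (W t) m) σ u v) :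
    u ⬝ᵥ (∑ j ∈ Finset.range m, upperProd (W t) (j + 1) m *
        (-η • ((upperProd (W t) (j + 1) m)ᵀ * M t * (layerProd (W t) j)ᵀ)) *
          layerProd (W t) j) *ᵥ v =
      -(η * m) * (σ ^ 2) ^ (1 - 1 / (m : ℝ)) * (u ⬝ᵥ M t *ᵥ v) := by
  -- The common eigenvalue of `W₁ᵀ W₁` at `v` and of `W_m W_mᵀ` at `u`: their `m`-th powers `Xᵀ X`
  -- and `X Xᵀ` have eigenvalue `σ²` there.
  set μ : ℝ := (σ ^ 2) ^ (1 / (m : ℝ)) with hμ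
  have hμ0 : 0 ≤ μ := by positivity
  have hm' : (m : ℝ) ≠ 0 := Nat.cast_ne_zero.2 hm
  have hμm : μ ^ m = σ ^ 2 := by
    rw [hμ, one_div, Real.rpow_inv_natCast_pow (by positivity) hm]
  have hμm1 : μ ^ (m - 1) = (σ ^ 2) ^ (1 - 1 / (m : ℝ)) := by
    rw [hμ, ← Real.rpow_natCast, ← Real.rpow_mul (by positivity),
      Nat.cast_sub (Nat.one_le_iff_ne_zero.2 hm), Nat.cast_one]
    congr 1
    field_simp
  have hv : ((W t 0)ᵀ * W t 0) *ᵥ v = μ • v := by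
    refine mulVec_eq_smul_of_pow_mulVec ?_ hμ0 hm ?_
    · simpa using Matrix.posSemidef_conjTranspose_mul_self (W t 0)
    · rw [← hW.transpose_layerProd_mul_layerProd le_rfl, ← Matrix.mulVec_mulVec, h.mulVec_right,
        Matrix.mulVec_smul, h.mulVec_left, smul_smul, hμm, pow_two]
  have hQ : ∀ j ≤ m, ((layerProd (W t) j)ᵀ * layerProd (W t) j) *ᵥ v = μ ^ j • v := fun j hj => by
    rw [hW.transpose_layerProd_mul_layerProd hj, pow_mulVec_of_mulVec_eq_smul hv]
  obtain ⟨m, rfl⟩ := Nat.exists_eq_succ_of_ne_zero hm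
  have hu : (W t m * (W t m)ᵀ) *ᵥ u = μ • u := by
    refine mulVec_eq_smul_of_pow_mulVec ?_ hμ0 hm ?_
    · simpa using Matrix.posSemidef_self_mul_conjTranspose (W t m)
    · have h1 := hW.upperProd_mul_transpose (Nat.zero_le (m + 1))
      have h2 := upperProd_mul_layerProd (W t) (Nat.zero_le (m + 1))
      rw [layerProd, Matrix.mul_one] at h2
      rw [h2, Nat.sub_zero] at h1
      rw [← h1, ← Matrix.mulVec_mulVec, h.mulVec_left, Matrix.mulVec_smul, h.mulVec_right, smul_smul,
        hμm, pow_two]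
  have hU : ∀ j ≤ m + 1, (upperProd (W t) j (m + 1) * (upperProd (W t) j (m + 1))ᵀ) *ᵥ u =
      μ ^ (m + 1 - j) • u := fun j hj => by
    rw [hW.upperProd_mul_transpose hj, pow_mulVec_of_mulVec_eq_smul hu]
  have hterm : ∀ j ∈ Finset.range (m + 1), u ⬝ᵥ (upperProd (W t) (j + 1) (m + 1) *
        (-η • ((upperProd (W t) (j + 1) (m + 1))ᵀ * M t * (layerProd (W t) j)ᵀ)) *
          layerProd (W t) j) *ᵥ v = -η * μ ^ m * (u ⬝ᵥ M t *ᵥ v) := by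
    intro j hj
    have hj' := Finset.mem_range.1 hj
    set U := upperProd (W t) (j + 1) (m + 1)
    set Q := layerProd (W t) j
    have h1 : (U * (-η • (Uᵀ * M t * Qᵀ)) * Q) *ᵥ v = -η • ((U * Uᵀ) *ᵥ (M t *ᵥ ((Qᵀ * Q) *ᵥ v))) := by
      simp only [Matrix.mulVec_mulVec, Matrix.mul_smul, Matrix.smul_mul, Matrix.smul_mulVec,
        Matrix.mul_assoc]
    have h2 : ∀ z, u ⬝ᵥ (U * Uᵀ) *ᵥ z = μ ^ (m - j) * (u ⬝ᵥ z) := by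
      intro z
      rw [Matrix.dotProduct_mulVec, ← Matrix.mulVec_transpose, Matrix.transpose_mul,
        Matrix.transpose_transpose, hU (j + 1) hj', smul_dotProduct, smul_eq_mul,
        Nat.add_sub_add_right]
    rw [h1, dotProduct_smul, h2, hQ j hj'.le, Matrix.mulVec_smul, dotProduct_smul, smul_eq_mul,
      smul_eq_mul]
    -- The layers above and below `j` contribute complementary powers, so the term does not depend
    -- on `j`. Here `m` is one less than the number of layers.
    have h3 : μ ^ (m - j) * μ ^ j = μ ^ m := by rw [← pow_add]; congr 1; omega
    rw [← h3]
    ring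
  rw [Matrix.sum_mulVec, dotProduct_sum, Finset.sum_congr rfl hterm, Finset.sum_const,
    Finset.card_range, nsmul_eq_mul, ← hμm1, Nat.succ_sub_one]
  ring

end Flow

/-! ### Analyticity of the layers -/

section Analytic

/-- The entries of a matrix-valued function lie in a given algebra of functions. -/
def EntriesIn {m n : Type*} (F : Subalgebra ℝ (ℝ → ℝ)) (X : ℝ → Matrix m n ℝ) : Prop :=
  ∀ a b, (fun t => X t a b) ∈ F

variable {m n p : Type*} {F : Subalgebra ℝ (ℝ → ℝ)} {X : ℝ → Matrix m n ℝ}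

theorem const_mem_subalgebra (c : ℝ) : (fun _ => c) ∈ F := F.algebraMap_mem c

theorem sum_mem_subalgebra {ι : Type*} {s : Finset ι} {f : ι → ℝ → ℝ} (h : ∀ i ∈ s, f i ∈ F) :
    (fun t => ∑ i ∈ s, f i t) ∈ F := by
  have := F.sum_mem h
  convert this using 1
  funext t
  simp

theorem EntriesIn.transpose (hX : EntriesIn F X) : EntriesIn F fun t => (X t)ᵀ := fun a b => hX b a

theorem EntriesIn.smul (hX : EntriesIn F X) (c : ℝ) : EntriesIn F fun t => c • X t := fun a b =>
  F.smul_mem (hX a b) c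

theorem EntriesIn.mul [Fintype n] {Y : ℝ → Matrix n p ℝ} (hX : EntriesIn F X) (hY : EntriesIn F Y) :
    EntriesIn F fun t => X t * Y t := fun a b => by
  simp only [Matrix.mul_apply]
  exact sum_mem_subalgebra fun i _ => F.mul_mem (hX a i) (hY i b)

variable {d : ℕ → ℕ} {W : ℝ → (j : ℕ) → Matrix (Fin (d (j + 1))) (Fin (d j)) ℝ} {k : ℕ}

/-- Keeping the algebra `F` arbitrary lets one induction serve twice: for polynomials in the weights
(`F` generated by their entries) and for continuity (`continuousOnSubalgebra`). -/
theorem entriesIn_layerProd (hW : ∀ j < k, EntriesIn F fun t => W t j) {j : ℕ} (hj : j ≤ k) :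
    EntriesIn F fun t => layerProd (W t) j := by
  induction j with
  | zero => exact fun a b => const_mem_subalgebra _
  | succ j ih => exact (hW j hj).mul (ih (by omega))

theorem entriesIn_upperProd (hW : ∀ j < k, EntriesIn F fun t => W t j) (i : ℕ) {j : ℕ} (hj : j ≤ k) :
    EntriesIn F fun t => upperProd (W t) i j := by
  induction j with
  | zero => exact fun a b => const_mem_subalgebra _
  | succ j ih =>
    by_cases h : i ≤ j
    · simp only [upperProd_succ _ h]
      exact (hW j hj).mul (ih (by omega))
    · simp only [upperProd, if_neg h]
      exact fun a b => const_mem_subalgebra _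

theorem entriesIn_tdGrad {S A : Type*} {n d₀ : ℕ} (x : S → A → Fin d₀ → ℝ) (data : Fin n → S × A)
    (y : S → A → ℝ) {E : ℝ → Matrix (Fin 1) (Fin d₀) ℝ} (hE : EntriesIn F E) :
    EntriesIn F fun t => tdGrad x data y (E t) := by
  intro a b
  have h (i : Fin n) : (fun t => (E t *ᵥ x (data i).1 (data i).2) 0) ∈ F :=
    sum_mem_subalgebra (s := Finset.univ) (f := fun c t => E t 0 c * x (data i).1 (data i).2 c) fun c _ =>
      F.mul_mem (hE 0 c) (const_mem_subalgebra _)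
  exact sum_mem_subalgebra (s := Finset.univ) (f := fun i t => 2 * ((E t *ᵥ x (data i).1 (data i).2) 0 -
    y (data i).1 (data i).2) * x (data i).1 (data i).2 b) fun i _ =>
    F.mul_mem (F.mul_mem (const_mem_subalgebra 2) (F.sub_mem (h i) (const_mem_subalgebra _)))
      (const_mem_subalgebra _)

/-- The algebra of the functions that are continuous on a given set. -/
def continuousOnSubalgebra (s : Set ℝ) : Subalgebra ℝ (ℝ → ℝ) where
  carrier := {f | ContinuousOn f s}
  mul_mem' := fun hf hg => hf.mul hg
  add_mem' := fun hf hg => hf.add hg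
  algebraMap_mem' := fun _ => continuousOn_const

theorem EntriesIn.continuousOn {s : Set ℝ} (hX : EntriesIn (continuousOnSubalgebra s) X) :
    ContinuousOn X s :=
  continuousOn_pi.2 fun a => continuousOn_pi.2 fun b => hX a b

end Analytic

/-! ### Singular value decompositions from eigenvectors -/

section SVD

theorem eq_of_mulVec_eq_of_orthonormal {m n : ℕ} {X Y : Matrix (Fin m) (Fin n) ℝ}
    {v : Fin n → Fin n → ℝ} (hv : ∀ r s, v r ⬝ᵥ v s = if r = s then 1 else 0)
    (h : ∀ i, X *ᵥ v i = Y *ᵥ v i) : X = Y := by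
  set V : Matrix (Fin n) (Fin n) ℝ := (Matrix.of v)ᵀ with hV
  have hVV : Vᵀ * V = 1 := by
    ext r s
    rw [Matrix.one_apply, ← hv r s]
    rfl
  have hXY : X * V = Y * V := by
    ext a i
    exact congrFun (h i) a
  calc X = X * (V * Vᵀ) := by rw [mul_eq_one_comm.1 hVV, Matrix.mul_one]
    _ = Y * (V * Vᵀ) := by rw [← Matrix.mul_assoc, hXY, Matrix.mul_assoc]
    _ = Y := by rw [mul_eq_one_comm.1 hVV, Matrix.mul_one]

theorem IsSVD.transpose_eq_sum {m n : ℕ} {X : Matrix (Fin m) (Fin n) ℝ} {σ : Fin (min n m) → ℝ}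
    {u : Fin (min n m) → Fin m → ℝ} {v : Fin (min n m) → Fin n → ℝ} (h : IsSVD X σ u v) :
    Xᵀ = ∑ r, σ r • Matrix.vecMulVec (v r) (u r) := by
  rw [h.eq_sum, Matrix.transpose_sum]
  simp [Matrix.transpose_smul, Matrix.transpose_vecMulVec]

theorem sum_smul_vecMulVec_mulVec {m n : Type*} [Fintype n] {ι : Type*} [Fintype ι]
    (σ : ι → ℝ) (u : ι → m → ℝ) (v : ι → n → ℝ) (z : n → ℝ) :
    (∑ r, σ r • Matrix.vecMulVec (u r) (v r)) *ᵥ z = ∑ r, (σ r * (v r ⬝ᵥ z)) • u r := by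
  rw [Matrix.sum_mulVec]
  refine Finset.sum_congr rfl fun r _ => ?_
  rw [Matrix.smul_mulVec, Matrix.vecMulVec_mulVec, mul_smul]
  congr 1
  ext a
  simp [mul_comm]

theorem IsSVD.isSingularTriple {m n : ℕ} {X : Matrix (Fin m) (Fin n) ℝ} {σ : Fin (min n m) → ℝ}
    {u : Fin (min n m) → Fin m → ℝ} {v : Fin (min n m) → Fin n → ℝ} (h : IsSVD X σ u v)
    (r : Fin (min n m)) : IsSingularTriple X (σ r) (u r) (v r) := by
  refine ⟨h.nonneg r, by simp [h.left_orthonormal], by simp [h.right_orthonormal], ?_, ?_⟩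
  · rw [h.eq_sum, sum_smul_vecMulVec_mulVec]
    simp [h.right_orthonormal]
  · rw [h.transpose_eq_sum, sum_smul_vecMulVec_mulVec]
    simp [h.left_orthonormal]

/-- A singular value decomposition built from eigenvectors of `Xᵀ X` and from vectors in the kernel
of `Xᵀ`. -/
theorem isSVD_of_eigenvectors {m n p : ℕ} {X : Matrix (Fin m) (Fin n) ℝ} (hpm : p ≤ m)
    {v : Fin n → Fin n → ℝ} {w : Fin m → Fin m → ℝ} {a : Fin n → ℝ}
    (hv : ∀ r s, v r ⬝ᵥ v s = if r = s then 1 else 0)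
    (hw : ∀ r s, w r ⬝ᵥ w s = if r = s then 1 else 0)
    (ha : ∀ i, (Xᵀ * X) *ᵥ v i = a i • v i) (hap : ∀ i : Fin n, a i ≠ 0 ↔ (i : ℕ) < p)
    (hz : ∀ j : Fin m, p ≤ j → Xᵀ *ᵥ w j = 0) :
    IsSVD X
      (fun r => √((X *ᵥ v (r.castLE (min_le_left _ _))) ⬝ᵥ (X *ᵥ v (r.castLE (min_le_left _ _)))))
      (fun r => if (r : ℕ) < p then
        (√((X *ᵥ v (r.castLE (min_le_left _ _))) ⬝ᵥ (X *ᵥ v (r.castLE (min_le_left _ _)))))⁻¹ •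
          (X *ᵥ v (r.castLE (min_le_left _ _))) else w (r.castLE (min_le_right _ _)))
      (fun r => v (r.castLE (min_le_left _ _))) := by
  have hdot : ∀ i j, (X *ᵥ v i) ⬝ᵥ (X *ᵥ v j) = if i = j then a j else 0 := by
    intro i j
    rw [Matrix.dotProduct_mulVec, ← Matrix.mulVec_transpose, Matrix.mulVec_mulVec, ha,
      smul_dotProduct, hv]
    by_cases h : i = j
    · simp [h]
    · simp [h]
  have ha0 : ∀ i, 0 ≤ a i := fun i => by
    have := real_dotProduct_self_nonneg (X *ᵥ v i)
    rwa [hdot, if_pos rfl] at this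
  have hX0 : ∀ i : Fin n, p ≤ i → X *ᵥ v i = 0 := fun i hi => by
    have h1 : a i = 0 := not_not.1 (mt (hap i).1 (not_lt.2 hi))
    have h2 := hdot i i
    rw [if_pos rfl, h1] at h2
    exact dotProduct_self_eq_zero.1 h2
  -- The range of `X` is orthogonal to the kernel of `Xᵀ`, so the two kinds of left vectors fit
  -- together.
  have hXw : ∀ (i : Fin n) (j : Fin m), p ≤ j → (X *ᵥ v i) ⬝ᵥ w j = 0 := fun i j hj => by
    rw [dotProduct_comm, Matrix.dotProduct_mulVec, ← Matrix.mulVec_transpose, hz j hj,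
      zero_dotProduct]
  simp only [hdot, if_true]
  have hn : min n m ≤ n := min_le_left _ _
  have hm : min n m ≤ m := min_le_right _ _
  have hsq : ∀ r : Fin (min n m), (r : ℕ) < p → √(a (r.castLE hn)) * √(a (r.castLE hn)) =
      a (r.castLE hn) := fun r _ => Real.mul_self_sqrt (ha0 _)
  have hpos : ∀ r : Fin (min n m), (r : ℕ) < p → √(a (r.castLE hn)) ≠ 0 := fun r hr =>
    (Real.sqrt_pos.2 ((ha0 _).lt_of_ne ((hap _).2 hr).symm)).ne'
  refine ⟨fun r => Real.sqrt_nonneg _, fun r s => ?_, fun r s => ?_, ?_⟩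
  · by_cases hr : (r : ℕ) < p <;> by_cases hs : (s : ℕ) < p
    · rw [if_pos hr, if_pos hs, smul_dotProduct, dotProduct_smul, hdot]
      simp only [Fin.castLE_inj]
      by_cases hrs : r = s
      · subst hrs
        rw [if_pos rfl, if_pos rfl, smul_eq_mul, smul_eq_mul]
        nth_rewrite 3 [← hsq r hr]
        have := hpos r hr
        field_simp
      · simp [hrs]
    · rw [if_pos hr, if_neg hs, smul_dotProduct, hXw _ _ (not_lt.1 hs), smul_zero,
        if_neg (by rintro rfl; exact hs hr)]
    · rw [if_neg hr, if_pos hs, dotProduct_smul, dotProduct_comm, hXw _ _ (not_lt.1 hr), smul_zero,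
        if_neg (by rintro rfl; exact hr hs)]
    · rw [if_neg hr, if_neg hs, hw]
      simp only [Fin.castLE_inj]
  · rw [hv]
    simp only [Fin.castLE_inj]
  · refine eq_of_mulVec_eq_of_orthonormal hv fun i => ?_
    rw [sum_smul_vecMulVec_mulVec]
    by_cases hi : (i : ℕ) < min n m
    · have hi' : Fin.castLE hn ⟨i, hi⟩ = i := rfl
      rw [Finset.sum_eq_single ⟨i, hi⟩]
      · rw [hi', hv, if_pos rfl, mul_one]
        split_ifs with hlt
        · have := hpos ⟨i, hi⟩ hlt
          rw [hi'] at this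
          rw [smul_smul, mul_inv_cancel₀ this, one_smul]
        · have h1 : a i = 0 := not_not.1 (mt (hap i).1 hlt)
          rw [h1, Real.sqrt_zero, zero_smul, hX0 i (not_lt.1 hlt)]
      · intro r _ hr
        rw [hv, if_neg (fun h => hr (Fin.castLE_injective hn (h.trans hi'.symm))), mul_zero,
          zero_smul]
      · simp
    · rw [hX0 i (by omega), Finset.sum_eq_zero]
      intro r _
      rw [hv, if_neg (fun h => hi (by rw [← h]; exact r.2)), mul_zero, zero_smul]

end SVD

/-! ### Eigenframes in a prescribed order -/

section Order

theorem exists_perm_lt_card {n : ℕ} (P : Fin n → Prop) [DecidablePred P] :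
    ∃ e : Equiv.Perm (Fin n), ∀ i, P (e i) ↔ (i : ℕ) < Fintype.card {i // P i} := by
  have hle : Fintype.card {i // P i} ≤ n := by
    simpa using Fintype.card_subtype_le P
  have hcard : Fintype.card {i : Fin n // (i : ℕ) < Fintype.card {i // P i}} =
      Fintype.card {i // P i} := by
    rw [Fintype.card_subtype]
    simp [Fin.card_filter_val_lt, hle]
  have e := Fintype.equivOfCardEq hcard
  refine ⟨e.extendSubtype, fun i => ⟨fun h => ?_, fun h => e.extendSubtype_mem i h⟩⟩
  by_contra hi
  exact e.extendSubtype_not_mem i hi h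

theorem rank_pow_eq_card {ι : Type*} [Fintype ι] [DecidableEq ι] {A V : Matrix ι ι ℝ} {ev : ι → ℝ}
    (hV : Vᵀ * V = 1) (h : A * V = V * Matrix.diagonal ev) {m : ℕ} (hm : m ≠ 0) :
    (A ^ m).rank = Fintype.card {i // ev i ≠ 0} := by
  have hdet : IsUnit V.det := by
    rw [← Matrix.isUnit_iff_isUnit_det]
    exact IsUnit.of_mul_eq_one_right _ hV
  have hpow : A ^ m * V = V * Matrix.diagonal (ev ^ m) := by
    rw [← Matrix.diagonal_pow]
    clear hm
    induction m with
    | zero => simp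
    | succ m ih => rw [pow_succ, Matrix.mul_assoc, h, ← Matrix.mul_assoc, ih, Matrix.mul_assoc, ← pow_succ]
  rw [← Matrix.rank_mul_eq_left_of_isUnit_det V (A ^ m) hdet, hpow,
    Matrix.rank_mul_eq_right_of_isUnit_det V _ hdet, Matrix.rank_diagonal]
  refine Fintype.card_congr (Equiv.subtypeEquivRight fun i => ?_)
  simp [hm]

/-- Because eigenvalues vanish always or never, one permutation, chosen at time `0`, puts the
nonzero ones first at all times. Counting them by the rank of a power of `A 0` makes the counts
comparable between `W₁ᵀ W₁` and `W_m W_mᵀ`, whose `m`-th powers are `Xᵀ X` and `X Xᵀ`. -/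
theorem IsEigenframe.exists_ordered {n : ℕ} {T : ℝ} (hT : 0 ≤ T)
    {A V : ℝ → Matrix (Fin n) (Fin n) ℝ} {ev : ℝ → Fin n → ℝ} (h : IsEigenframe A V ev (Icc 0 T))
    (hzero : ∀ (v : ℝ → Fin n → ℝ) (μ : ℝ → ℝ), ContinuousOn v (Icc 0 T) →
      (∀ t ∈ Icc 0 T, v t ⬝ᵥ v t = 1) → (∀ t ∈ Icc 0 T, A t *ᵥ v t = μ t • v t) →
      ∀ t₀ ∈ Icc 0 T, μ t₀ = 0 → ∀ t ∈ Icc 0 T, μ t = 0) :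
    ∃ (v : ℝ → Fin n → Fin n → ℝ) (μ : ℝ → Fin n → ℝ),
      (∀ i, ContinuousOn (fun t => v t i) (Icc 0 T)) ∧
      (∀ t ∈ Icc 0 T, ∀ i j, v t i ⬝ᵥ v t j = if i = j then 1 else 0) ∧
      (∀ t ∈ Icc 0 T, ∀ i, A t *ᵥ v t i = μ t i • v t i) ∧
      ∀ t ∈ Icc 0 T, ∀ i, ∀ m ≠ 0, μ t i ≠ 0 ↔ (i : ℕ) < (A 0 ^ m).rank := by
  classical
  have h0 : (0 : ℝ) ∈ Icc 0 T := ⟨le_rfl, hT⟩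
  have hcont : ∀ i, ContinuousOn (fun t a => V t a i) (Icc 0 T) := fun i =>
    continuousOn_pi.2 fun a => continuousOn_pi.1 (continuousOn_pi.1 h.continuousOn a) i
  have horth : ∀ t ∈ Icc 0 T, ∀ i j,
      (fun a => V t a i) ⬝ᵥ (fun a => V t a j) = if i = j then 1 else 0 := fun t ht i j => by
    rw [← Matrix.one_apply, ← h.transpose_mul t ht]
    rfl
  have heig : ∀ t ∈ Icc 0 T, ∀ i, A t *ᵥ (fun a => V t a i) = ev t i • fun a => V t a i := by
    intro t ht i
    ext a
    have := congrFun (congrFun (h.mul_eq t ht) a) i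
    rw [Matrix.mul_diagonal, mul_comm] at this
    exact this
  have hz : ∀ i, ∀ t₀ ∈ Icc 0 T, ev t₀ i = 0 → ∀ t ∈ Icc 0 T, ev t i = 0 := fun i =>
    hzero _ (fun t => ev t i) (hcont i) (fun t ht => by rw [horth t ht, if_pos rfl])
      (fun t ht => heig t ht i)
  obtain ⟨e, he⟩ := exists_perm_lt_card fun i => ev 0 i ≠ 0
  refine ⟨fun t i a => V t a (e i), fun t i => ev t (e i), fun i => hcont (e i),
    fun t ht i j => by simpa using horth t ht (e i) (e j), fun t ht i => heig t ht (e i),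
    fun t ht i m hm => ?_⟩
  rw [rank_pow_eq_card (h.transpose_mul 0 h0) (h.mul_eq 0 h0) hm]
  exact (not_congr ⟨fun H => hz _ t ht H 0 h0, fun H => hz _ 0 h0 H t ht⟩).trans (he i)

end Order

/-! ### Singular value decomposition along the flow -/

section FlowSVD

variable {d : ℕ → ℕ} {p : ℕ} {η T : ℝ}
  {W : ℝ → (j : ℕ) → Matrix (Fin (d (j + 1))) (Fin (d j)) ℝ}

theorem IsLayerFlow.entriesIn_continuousOn {m : ℕ} {M : ℝ → Matrix (Fin (d m)) (Fin (d 0)) ℝ}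
    (h : IsLayerFlow m η T W M) :
    ∀ j < m, EntriesIn (continuousOnSubalgebra (Icc 0 T)) fun t => W t j :=
  fun j hj a b t ht => (h t ht j hj a b).continuousWithinAt

variable {M : ℝ → Matrix (Fin (d (p + 2))) (Fin (d 0)) ℝ}

/-- An eigenvalue of `W₁ᵀ W₁` with a continuous eigenvector vanishes nowhere or everywhere. -/
theorem IsLayerFlow.first_eigenvalue_eq_zero (h : IsLayerFlow (p + 2) η T W M)
    (hW : BalancedLayers (W 0) (p + 2)) (hM : EntriesIn (continuousOnSubalgebra (Icc 0 T)) M)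
    {v : ℝ → Fin (d 0) → ℝ} {μ : ℝ → ℝ} (hv : ContinuousOn v (Icc 0 T))
    (hv1 : ∀ t ∈ Icc 0 T, v t ⬝ᵥ v t = 1)
    (hμ : ∀ t ∈ Icc 0 T, ((W t 0)ᵀ * W t 0) *ᵥ v t = μ t • v t) {t₀ : ℝ}
    (ht₀ : t₀ ∈ Icc 0 T) (h0 : μ t₀ = 0) : ∀ t ∈ Icc 0 T, μ t = 0 := by
  refine eigenvalue_eq_zero_of_eq_zero (Y := fun t => W t 1)
    (R := fun t => -η • ((upperProd (W t) 2 (p + 2))ᵀ * M t)) (fun t ht => ?_)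
    (fun t ht => h.balanced hW t ht 0 (by omega)) ?_ hv hv1 hμ ht₀ h0
  · convert h t ht 0 (by omega) using 1
    rw [← upperProd_succ_mul (W t) (show 0 + 1 < p + 2 by omega), layerProd, Matrix.transpose_one,
      Matrix.mul_one, Matrix.transpose_mul, Matrix.mul_smul, Matrix.mul_assoc]
  · exact (((entriesIn_upperProd h.entriesIn_continuousOn 2 le_rfl).transpose.mul hM).smul
      (-η)).continuousOn

/-- An eigenvalue of `Wₘ Wₘᵀ` with a continuous eigenvector vanishes nowhere or everywhere. -/
theorem IsLayerFlow.last_eigenvalue_eq_zero (h : IsLayerFlow (p + 2) η T W M)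
    (hW : BalancedLayers (W 0) (p + 2)) (hM : EntriesIn (continuousOnSubalgebra (Icc 0 T)) M)
    {v : ℝ → Fin (d (p + 2)) → ℝ} {μ : ℝ → ℝ} (hv : ContinuousOn v (Icc 0 T))
    (hv1 : ∀ t ∈ Icc 0 T, v t ⬝ᵥ v t = 1)
    (hμ : ∀ t ∈ Icc 0 T, (W t (p + 1) * (W t (p + 1))ᵀ) *ᵥ v t = μ t • v t) {t₀ : ℝ}
    (ht₀ : t₀ ∈ Icc 0 T) (h0 : μ t₀ = 0) : ∀ t ∈ Icc 0 T, μ t = 0 := by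
  -- Transposition exchanges the roles of the two ends of the product; the layer below the last one
  -- now plays the part of the second layer.
  refine eigenvalue_eq_zero_of_eq_zero (Z := fun t => (W t (p + 1))ᵀ) (Y := fun t => (W t p)ᵀ)
    (R := fun t => -η • (layerProd (W t) p * (M t)ᵀ)) (fun t ht => ?_)
    (fun t ht => ?_) ?_ hv hv1 (fun t ht => ?_) ht₀ h0
  · convert (h t ht (p + 1) (by omega)).transpose using 1
    rw [upperProd_self, Matrix.transpose_one, Matrix.one_mul, layerProd, Matrix.transpose_transpose,
      Matrix.transpose_smul, Matrix.transpose_mul, Matrix.transpose_transpose, Matrix.mul_smul,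
      Matrix.mul_assoc]
  · rw [Matrix.transpose_transpose, Matrix.transpose_transpose]
    exact (h.balanced hW t ht p (by omega)).symm
  · exact (((entriesIn_layerProd h.entriesIn_continuousOn (show p ≤ p + 2 by omega)).mul
      hM.transpose).smul (-η)).continuousOn
  · rw [Matrix.transpose_transpose]
    exact hμ t ht

theorem continuousOn_mulVec {m n : Type*} [Fintype n] {X : ℝ → Matrix m n ℝ} {v : ℝ → n → ℝ} {s : Set ℝ}
    (hX : ContinuousOn X s) (hv : ContinuousOn v s) : ContinuousOn (fun t => X t *ᵥ v t) s :=
  continuousOn_pi.2 fun a => continuousOn_finsetSum _ fun b _ =>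
    (continuousOn_pi.1 (continuousOn_pi.1 hX a) b).mul (continuousOn_pi.1 hv b)

theorem continuousOn_dotProduct {n : Type*} [Fintype n] {u v : ℝ → n → ℝ} {s : Set ℝ}
    (hu : ContinuousOn u s) (hv : ContinuousOn v s) : ContinuousOn (fun t => u t ⬝ᵥ v t) s :=
  continuousOn_finsetSum _ fun b _ => (continuousOn_pi.1 hu b).mul (continuousOn_pi.1 hv b)

/-- Along the gradient flow of balanced, locally analytic layers there is a continuous singular value
decomposition of the product of the layers. -/
theorem IsLayerFlow.exists_isSVD (h : IsLayerFlow (p + 2) η T W M) (hT : 0 ≤ T)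
    (hW : BalancedLayers (W 0) (p + 2)) (hM : EntriesIn (continuousOnSubalgebra (Icc 0 T)) M)
    (hA : ∀ t₀ ∈ Icc 0 T, ∃ Z : ℝ → (j : ℕ) → Matrix (Fin (d (j + 1))) (Fin (d j)) ℝ,
      (∀ j < p + 2, ∀ a b, AnalyticAt ℝ (fun t => Z t j a b) t₀) ∧
      ∀ᶠ t in 𝓝[Icc 0 T] t₀, ∀ j < p + 2, W t j = Z t j) :
    ∃ (σ : Fin (min (d 0) (d (p + 2))) → ℝ → ℝ)
      (u : Fin (min (d 0) (d (p + 2))) → ℝ → Fin (d (p + 2)) → ℝ)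
      (v : Fin (min (d 0) (d (p + 2))) → ℝ → Fin (d 0) → ℝ),
      (∀ r, ContinuousOn (u r) (Icc 0 T)) ∧ (∀ r, ContinuousOn (v r) (Icc 0 T)) ∧
      ∀ t ∈ Icc 0 T, IsSVD (layerProd (W t) (p + 2)) (fun r => σ r t) (fun r => u r t)
        (fun r => v r t) := by
  have h0 : (0 : ℝ) ∈ Icc 0 T := ⟨le_rfl, hT⟩
  obtain ⟨V, ev, hV⟩ := exists_isEigenframe (A := fun t => (W t 0)ᵀ * W t 0) hT fun t₀ ht₀ => by
    obtain ⟨Z, hZ, hWZ⟩ := hA t₀ ht₀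
    refine ⟨fun t => (Z t 0)ᵀ * Z t 0, fun a b => ?_, fun t => ?_, ?_⟩
    · simp only [Matrix.mul_apply, Matrix.transpose_apply]
      exact Finset.analyticAt_fun_sum _ fun i _ =>
        (hZ 0 (by omega) i a).mul (hZ 0 (by omega) i b)
    · rw [Matrix.transpose_mul, Matrix.transpose_transpose]
    · filter_upwards [hWZ] with t ht
      rw [ht 0 (by omega)]
  obtain ⟨V', ev', hV'⟩ := exists_isEigenframe
    (A := fun t => W t (p + 1) * (W t (p + 1))ᵀ) hT fun t₀ ht₀ => by
    obtain ⟨Z, hZ, hWZ⟩ := hA t₀ ht₀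
    refine ⟨fun t => Z t (p + 1) * (Z t (p + 1))ᵀ, fun a b => ?_, fun t => ?_, ?_⟩
    · simp only [Matrix.mul_apply, Matrix.transpose_apply]
      exact Finset.analyticAt_fun_sum _ fun i _ =>
        (hZ (p + 1) (by omega) a i).mul (hZ (p + 1) (by omega) b i)
    · rw [Matrix.transpose_mul, Matrix.transpose_transpose]
    · filter_upwards [hWZ] with t ht
      rw [ht (p + 1) (by omega)]
  obtain ⟨v, μ, hvc, hvo, hvμ, hμ⟩ := hV.exists_ordered hT fun v μ hv hv1 hvμ t₀ ht₀ hμ0 =>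
    h.first_eigenvalue_eq_zero hW hM hv hv1 hvμ ht₀ hμ0
  obtain ⟨w, ν, hwc, hwo, hwν, hν⟩ := hV'.exists_ordered hT fun v μ hv hv1 hvμ t₀ ht₀ hμ0 =>
    h.last_eigenvalue_eq_zero hW hM hv hv1 hvμ ht₀ hμ0
  set X : ℝ → Matrix (Fin (d (p + 2))) (Fin (d 0)) ℝ := fun t => layerProd (W t) (p + 2) with hX
  have hXX : ∀ t ∈ Icc 0 T, (X t)ᵀ * X t = ((W t 0)ᵀ * W t 0) ^ (p + 2) := fun t ht =>
    (h.balanced hW t ht).transpose_layerProd_mul_layerProd le_rfl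
  have hXX' : ∀ t ∈ Icc 0 T, X t * (X t)ᵀ = (W t (p + 1) * (W t (p + 1))ᵀ) ^ (p + 2) := by
    intro t ht
    have h1 := (h.balanced hW t ht).upperProd_mul_transpose (Nat.zero_le (p + 2))
    have h2 := upperProd_mul_layerProd (W t) (Nat.zero_le (p + 2))
    rw [layerProd, Matrix.mul_one] at h2
    rwa [h2] at h1
  -- Since `Xᵀ X` and `X Xᵀ` have the rank of `X`, both frames have exactly `c` nonzero eigenvalues,
  -- so the null vectors of the second complete the left vectors from the first.
  set c : ℕ := (X 0).rank with hc
  have hμc : ∀ t ∈ Icc 0 T, ∀ i, μ t i ≠ 0 ↔ (i : ℕ) < c := fun t ht i => by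
    rw [hμ t ht i (p + 2) (by omega), ← hXX 0 h0, Matrix.rank_transpose_mul_self]
  have hνc : ∀ t ∈ Icc 0 T, ∀ i, ν t i ≠ 0 ↔ (i : ℕ) < c := fun t ht i => by
    rw [hν t ht i (p + 2) (by omega), ← hXX' 0 h0, Matrix.rank_self_mul_transpose]
  have hsvd : ∀ t ∈ Icc 0 T, IsSVD (X t) _ _ _ := fun t ht =>
    isSVD_of_eigenvectors (p := c) (v := v t) (w := w t) (a := fun i => μ t i ^ (p + 2))
      (Matrix.rank_le_height (X 0)) (hvo t ht)
      (hwo t ht) (fun i => by rw [hXX t ht, pow_mulVec_of_mulVec_eq_smul (hvμ t ht i)])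
      (fun i => by rw [← hμc t ht i, pow_ne_zero_iff (by omega)]) (fun j hj => by
        have h1 : ν t j = 0 := not_not.1 (mt (hνc t ht j).1 (not_lt.2 hj))
        have h2 : (X t * (X t)ᵀ) *ᵥ w t j = 0 := by
          rw [hXX' t ht, pow_mulVec_of_mulVec_eq_smul (hwν t ht j), h1,
            zero_pow (by omega), zero_smul]
        have h3 : ((X t)ᵀ *ᵥ w t j) ⬝ᵥ ((X t)ᵀ *ᵥ w t j) = 0 := by
          rw [Matrix.dotProduct_mulVec, Matrix.vecMul_transpose, Matrix.mulVec_mulVec, h2,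
            zero_dotProduct]
        exact dotProduct_self_eq_zero.1 h3)
  have hXc : ContinuousOn X (Icc 0 T) :=
    (entriesIn_layerProd h.entriesIn_continuousOn le_rfl).continuousOn
  have hXv : ∀ i, ContinuousOn (fun t => X t *ᵥ v t i) (Icc 0 T) := fun i =>
    continuousOn_mulVec hXc (hvc i)
  refine ⟨fun r t => _, fun r t => _, fun r t => _, fun r => ?_, fun r => ?_, hsvd⟩
  · by_cases hr : (r : ℕ) < c
    · simp only [if_pos hr]
      refine ContinuousOn.smul (ContinuousOn.inv₀ (continuousOn_dotProduct (hXv _) (hXv _)).sqrt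
        fun t ht => ?_) (hXv _)
      set i := r.castLE (min_le_left (d 0) (d (p + 2))) with hi
      have h1 : X t *ᵥ v t i ⬝ᵥ X t *ᵥ v t i = μ t i ^ (p + 2) := by
        rw [Matrix.dotProduct_mulVec, ← Matrix.mulVec_transpose, Matrix.mulVec_mulVec, hXX t ht,
          pow_mulVec_of_mulVec_eq_smul (hvμ t ht i), smul_dotProduct, hvo t ht, if_pos rfl,
          smul_eq_mul, mul_one]
      have h2 := real_dotProduct_self_nonneg (X t *ᵥ v t i)
      refine (Real.sqrt_pos.2 (h2.lt_of_ne ?_)).ne'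
      rw [h1]
      exact (pow_ne_zero _ ((hμc t ht i).2 hr)).symm
    · simp only [if_neg hr]
      exact hwc _
  · exact hvc _

end FlowSVD

/-! ### Fitted Q-iteration -/

section Network

variable {S A : Type*} {N n : ℕ} {d : ℕ → ℕ} (x : S → A → Fin (d 0) → ℝ) (data : Fin n → S × A)
  (y : S → A → ℝ)

theorem gradHidden_tdLoss (θ : Weights N d) {j : ℕ} (hj : j < N - 1) :
    gradHidden (tdLoss x data y) θ j = (upperProd θ.hidden (j + 1) (N - 1))ᵀ *
      (θ.lastᵀ * tdGrad x data y θ.endToEnd) * (layerProd θ.hidden j)ᵀ := by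
  have h1 : (fun X => tdLoss x data y
      (Weights.endToEnd { θ with hidden := Function.update θ.hidden j X })) = fun X =>
      tdLoss x data y ((θ.last * upperProd θ.hidden (j + 1) (N - 1)) * X * layerProd θ.hidden j) := by
    funext X
    simp only [Weights.endToEnd, Weights.feature, layerProd_update _ hj, Matrix.mul_assoc]
  have h2 : (θ.last * upperProd θ.hidden (j + 1) (N - 1)) * θ.hidden j * layerProd θ.hidden j =
      θ.endToEnd := by
    rw [Weights.endToEnd, Weights.feature, ← upperProd_mul_layerProd θ.hidden hj, layerProd]
    simp only [Matrix.mul_assoc]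
  rw [gradHidden, h1, matGrad_tdLoss_comp, h2, Matrix.transpose_mul]
  simp only [Matrix.mul_assoc]

theorem gradLast_tdLoss (θ : Weights N d) :
    gradLast (tdLoss x data y) θ = tdGrad x data y θ.endToEnd * θ.featureᵀ := by
  have h1 : (fun X => tdLoss x data y (Weights.endToEnd { θ with last := X })) =
      fun X : Matrix (Fin 1) (Fin (d (N - 1))) ℝ =>
      tdLoss x data y ((1 : Matrix (Fin 1) (Fin 1) ℝ) * X * θ.feature) := by
    funext X
    rw [Matrix.one_mul]
    rfl
  rw [gradLast, h1, matGrad_tdLoss_comp, Matrix.transpose_one, Matrix.one_mul, Matrix.one_mul]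
  rfl

/-- The index set of the entries of the weights. -/
abbrev EntryIndex (N : ℕ) (d : ℕ → ℕ) : Type :=
  (Σ j : Fin (N - 1), Fin (d (j + 1)) × Fin (d j)) ⊕ Fin 1 × Fin (d (N - 1))

/-- The entries of a curve of weights. -/
def Weights.entry (θ : ℝ → Weights N d) : EntryIndex N d → ℝ → ℝ :=
  Sum.elim (fun i t => (θ t).hidden i.1 i.2.1 i.2.2) fun b t => (θ t).last b.1 b.2

/-- The velocity of the entries of a curve of weights along the gradient flow of the squared TD error. -/
def Weights.entryVelocity (η : ℝ) (θ : ℝ → Weights N d) : EntryIndex N d → ℝ → ℝ :=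
  Sum.elim
    (fun i t => (-η • ((upperProd (θ t).hidden (i.1 + 1) (N - 1))ᵀ *
      ((θ t).lastᵀ * tdGrad x data y (θ t).endToEnd) * (layerProd (θ t).hidden i.1)ᵀ)) i.2.1 i.2.2)
    fun b t => (-η • (tdGrad x data y (θ t).endToEnd * (θ t).featureᵀ)) b.1 b.2

variable {F : Subalgebra ℝ (ℝ → ℝ)} {θ : ℝ → Weights N d}

theorem entriesIn_hidden (hF : ∀ i, Weights.entry θ i ∈ F) : ∀ j < N - 1, EntriesIn F fun t => (θ t).hidden j :=
  fun j hj a b => hF (.inl ⟨⟨j, hj⟩, a, b⟩)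

theorem entriesIn_last (hF : ∀ i, Weights.entry θ i ∈ F) :
    EntriesIn F fun t => (θ t).last := fun a b => hF (.inr (a, b))

theorem entriesIn_tdGrad_endToEnd (hF : ∀ i, Weights.entry θ i ∈ F) :
    EntriesIn F fun t => tdGrad x data y (θ t).endToEnd :=
  entriesIn_tdGrad x data y ((entriesIn_last hF).mul
    (entriesIn_layerProd (entriesIn_hidden hF) le_rfl))

/-- With `F` generated by the weight entries this says that the flow is a polynomial system: the
targets `y` are constant in time and `tdGrad` is affine in the end-to-end matrix. -/
theorem entryVelocity_mem (hF : ∀ i, Weights.entry θ i ∈ F) (η : ℝ) (i : EntryIndex N d) :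
    Weights.entryVelocity x data y η θ i ∈ F := by
  have hG := entriesIn_tdGrad_endToEnd x data y hF
  have hW := entriesIn_hidden hF
  rcases i with ⟨j, a, b⟩ | ⟨a, b⟩
  · exact ((((entriesIn_upperProd hW (j + 1) le_rfl).transpose.mul
      ((entriesIn_last hF).transpose.mul hG)).mul (entriesIn_layerProd hW j.2.le).transpose).smul
      (-η)) a b
  · exact ((hG.mul (entriesIn_layerProd hW le_rfl).transpose).smul (-η)) a b

end Network

section Fitting

variable {S A : Type*} [MeasurableSpace S] [MeasurableSpace A] {N n : ℕ} {d : ℕ → ℕ}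
  {M : MDP S A} {pol : ProbabilityTheory.Kernel S A} {x : S → A → Fin (d 0) → ℝ}
  {data : Fin n → S × A} {η T : ℝ} {θ : ℕ → ℝ → Weights N d}

theorem IsFittedQFlow.isLayerFlow (h : IsFittedQFlow M pol x data η T θ) (k : ℕ) :
    IsLayerFlow (N - 1) η T (fun t => (θ k t).hidden) fun t =>
      (θ k t).lastᵀ * tdGrad x data (M.bellman pol ((θ k 0).qFun x)) (θ k t).endToEnd := by
  intro t ht j hj a b
  refine (h.flow_hidden k t ht j hj a b).congr_deriv ?_
  rw [fittingLoss, gradHidden_tdLoss x data _ _ hj]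
  rfl

theorem IsFittedQFlow.hasDerivWithinAt_entry (h : IsFittedQFlow M pol x data η T θ) (k : ℕ)
    {t : ℝ} (ht : t ∈ Icc 0 T) (i : EntryIndex N d) :
    HasDerivWithinAt (Weights.entry (θ k) i)
      (Weights.entryVelocity x data (M.bellman pol ((θ k 0).qFun x)) η (θ k) i t) (Icc 0 T) t := by
  rcases i with ⟨j, a, b⟩ | ⟨a, b⟩
  · exact h.isLayerFlow k t ht j j.2 a b
  · refine (h.flow_last k t ht a b).congr_deriv ?_
    rw [fittingLoss, gradLast_tdLoss]
    rfl

theorem IsFittedQFlow.entry_mem (h : IsFittedQFlow M pol x data η T θ) (k : ℕ)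
    (i : EntryIndex N d) : Weights.entry (θ k) i ∈ continuousOnSubalgebra (Icc 0 T) :=
  fun _ ht => (h.hasDerivWithinAt_entry k ht i).continuousWithinAt

/-- Within an iteration the layers are locally analytic functions of time. -/
theorem IsFittedQFlow.exists_analytic (h : IsFittedQFlow M pol x data η T θ) (k : ℕ) {t₀ : ℝ}
    (ht₀ : t₀ ∈ Icc 0 T) :
    ∃ Z : ℝ → (j : ℕ) → Matrix (Fin (d (j + 1))) (Fin (d j)) ℝ,
      (∀ j < N - 1, ∀ a b, AnalyticAt ℝ (fun t => Z t j a b) t₀) ∧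
      ∀ᶠ t in 𝓝[Icc 0 T] t₀, ∀ j < N - 1, (θ k t).hidden j = Z t j := by
  obtain ⟨z, hz, hyz⟩ := analytic_of_polynomial
    (fun i => entryVelocity_mem x data (M.bellman pol ((θ k 0).qFun x))
      (fun i => Algebra.subset_adjoin (mem_range_self i)) η i)
    (fun t ht i => h.hasDerivWithinAt_entry k ht i) ht₀
  refine ⟨fun t j a b => if hj : j < N - 1 then z (.inl ⟨⟨j, hj⟩, a, b⟩) t else 0,
    fun j hj a b => ?_, ?_⟩
  · simp only [dif_pos hj]
    exact hz _
  · filter_upwards [hyz] with t ht j hj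
    ext a b
    rw [dif_pos hj, ← ht]
    rfl

/-- The first layers stay balanced throughout the training. -/
theorem IsFittedQFlow.balanced (h : IsFittedQFlow M pol x data η T θ) (hT : 0 ≤ T)
    (h0 : (θ 0 0).Balanced) (k : ℕ) : ∀ t ∈ Icc 0 T, BalancedLayers (θ k t).hidden (N - 1) := by
  induction k with
  | zero => exact (h.isLayerFlow 0).balanced h0
  | succ k ih =>
    refine (h.isLayerFlow (k + 1)).balanced fun j hj => ?_
    rw [h.restart_hidden k j (by omega), h.restart_hidden k (j + 1) hj]
    exact ih T ⟨hT, le_rfl⟩ j hj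

/-- A singular value of the feature matrix with continuous singular vectors evolves with the singular
velocity. -/
theorem IsFittedQFlow.hasDerivWithinAt_singularValue (h : IsFittedQFlow M pol x data η T θ)
    (hN : 2 ≤ N) (hT : 0 ≤ T) (h0 : (θ 0 0).Balanced) (k : ℕ) {I : Set ℝ} (hI : I ⊆ Icc 0 T)
    {σ : ℝ → ℝ} {u : ℝ → Fin (d (N - 1)) → ℝ} {v : ℝ → Fin (d 0) → ℝ} (hu : ContinuousOn u I)
    (hv : ContinuousOn v I)
    (hσ : ∀ t ∈ I, IsSingularTriple (θ k t).feature (σ t) (u t) (v t)) {t : ℝ} (ht : t ∈ I) :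
    HasDerivWithinAt σ (singularVelocity η (fittingLoss M pol x data (θ k 0)) (θ k t)
      (σ t) (u t) (v t)) I t := by
  have h1 := (h.isLayerFlow k).hasMatDerivWithinAt_layerProd (hI ht) le_rfl
  refine (DeepQ.hasDerivWithinAt_singularValue (fun a b => (h1 a b).mono hI) hu hv hσ
    ht).congr_deriv ?_
  rw [IsLayerFlow.dotProduct_velocity (W := fun t => (θ k t).hidden)
    (M := fun t => (θ k t).lastᵀ * tdGrad x data (M.bellman pol ((θ k 0).qFun x)) (θ k t).endToEnd)
    (by omega) (h.balanced hT h0 k t (hI ht)) (hσ t ht), singularVelocity, frob_vecMulVec,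
    fittingLoss, matGrad_tdLoss, Nat.cast_sub (by omega : 1 ≤ N), Nat.cast_one]

/-- Within an iteration there is a continuous singular value decomposition of the feature matrix. -/
theorem IsFittedQFlow.exists_isSVD (h : IsFittedQFlow M pol x data η T θ)
    (hN : 3 ≤ N) (hT : 0 ≤ T) (h0 : (θ 0 0).Balanced) (k : ℕ) :
    ∃ (σ : Fin (min (d 0) (d (N - 1))) → ℝ → ℝ)
      (u : Fin (min (d 0) (d (N - 1))) → ℝ → Fin (d (N - 1)) → ℝ)
      (v : Fin (min (d 0) (d (N - 1))) → ℝ → Fin (d 0) → ℝ),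
      (∀ r, ContinuousOn (u r) (Icc 0 T)) ∧ (∀ r, ContinuousOn (v r) (Icc 0 T)) ∧
      ∀ t ∈ Icc 0 T, IsSVD (θ k t).feature (fun r => σ r t) (fun r => u r t) (fun r => v r t) := by
  -- With `N = p + 3`, the number `N - 1` of hidden layers reduces definitionally to `p + 2`.
  obtain ⟨p, rfl⟩ := Nat.exists_eq_add_of_le' hN
  have hF := h.entry_mem k
  exact (h.isLayerFlow k).exists_isSVD (p := p) hT (h.balanced hT h0 k 0 ⟨le_rfl, hT⟩)
    ((entriesIn_last hF).transpose.mul (entriesIn_tdGrad_endToEnd x data _ hF))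
    fun t₀ ht₀ => h.exists_analytic k ht₀

end Fitting

end DeepQ

theorem mainTheorem3 {S A : Type*} [MeasurableSpace S] [MeasurableSpace A]
    (M : DeepQ.MDP S A) (pol : ProbabilityTheory.Kernel S A)
    [ProbabilityTheory.IsMarkovKernel pol]
    (N : ℕ) (hN : 3 ≤ N) (d : ℕ → ℕ)
    -- the input vectors `[s; a]`, with finite expectation under the law of the next pair
    (x : S → A → Fin (d 0) → ℝ)
    (hx : ∀ s a, MeasureTheory.Integrable (fun p : S × A => x p.1 p.2) (M.nextLaw pol s a))
    {n : ℕ} (data : Fin n → S × A)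
    (η : ℝ) (hη : 0 < η) (T : ℝ) (hT : 0 < T)
    (θ : ℕ → ℝ → DeepQ.Weights N d)
    (hflow : DeepQ.IsFittedQFlow M pol x data η T θ)
    (hbal : (θ 0 0).Balanced) (k : ℕ) :
    -- during iteration `k` there is a continuous singular value decomposition of the feature
    -- matrix, all of whose singular values satisfy the differential equation
    (∃ (σ : Fin (min (d 0) (d (N - 1))) → ℝ → ℝ)
        (u : Fin (min (d 0) (d (N - 1))) → ℝ → Fin (d (N - 1)) → ℝ)
        (v : Fin (min (d 0) (d (N - 1))) → ℝ → Fin (d 0) → ℝ),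
        (∀ r, ContinuousOn (u r) (Set.Icc 0 T)) ∧
        (∀ r, ContinuousOn (v r) (Set.Icc 0 T)) ∧
        (∀ t ∈ Set.Icc 0 T,
          DeepQ.IsSVD (θ k t).feature (fun r => σ r t) (fun r => u r t) (fun r => v r t)) ∧
        ∀ r, ∀ t ∈ Set.Icc 0 T,
          HasDerivWithinAt (σ r)
            (DeepQ.singularVelocity η (DeepQ.fittingLoss M pol x data (θ k 0)) (θ k t)
              (σ r t) (u r t) (v r t)) (Set.Icc 0 T) t) ∧
    -- and every singular value with continuous singular vectors does so, on any set of times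
    (∀ I ⊆ Set.Icc 0 T, ∀ (σ : ℝ → ℝ) (u : ℝ → Fin (d (N - 1)) → ℝ) (v : ℝ → Fin (d 0) → ℝ),
      ContinuousOn u I → ContinuousOn v I →
      (∀ t ∈ I, DeepQ.IsSingularTriple (θ k t).feature (σ t) (u t) (v t)) →
      ∀ t ∈ I,
        HasDerivWithinAt σ
          (DeepQ.singularVelocity η (DeepQ.fittingLoss M pol x data (θ k 0)) (θ k t)
            (σ t) (u t) (v t)) I t) := by
  obtain ⟨σ, u, v, hu, hv, hσ⟩ := hflow.exists_isSVD hN hT.le hbal k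
  refine ⟨⟨σ, u, v, hu, hv, hσ, fun r t ht => ?_⟩, fun I hI σ u v hu hv hσ t ht => ?_⟩
  · exact hflow.hasDerivWithinAt_singularValue (by omega) hT.le hbal k subset_rfl (hu r) (hv r)
      (fun t ht => (hσ t ht).isSingularTriple r) ht
  · exact hflow.hasDerivWithinAt_singularValue (by omega) hT.le hbal k hI hu hv hσ ht
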